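/- Let $Z$ be a random variable with law $P$ on a measurable space $\mathcal Z$, let $\Theta\subseteq\mathbb R^p$ be open and convex, and let $f:\mathcal Z\times\Theta\to[0,\infty)$ be a loss function such that $f(\cdot,\theta)$ is measurable for every $\theta\in\Theta$. Let $R(\theta)=\mathbb E[f(Z,\theta)]\in[0,\infty]$ be the population risk, and suppose that $R$ has a unique minimizer $\theta^*$ in $\Theta$. For i.i.d. observations $Z_1,Z_2,\dots$ with law $P$, let $\hat\theta_n=\hat\theta_n(Z_1,\dots,Z_n)\in\Theta$ be a measurable minimizer over $\Theta$ of the empirical risk $\hat R_n(\theta)=\frac1n\sum_{i=1}^n f(Z_i,\theta)$. It suffices that, for every $\varepsilon>0$, with probability tending to one as $n\to\infty$, $\hat\theta_n\in\Theta$ and $\hat R_n(\hat\theta_n)\le \hat R_n(\theta)+\varepsilon/n$ for all $\theta\in\Theta$. Fix $p$ and the number $m\ge1$ of machines, and let $N=mn$. The observations $Z_1,\dots,Z_N$ are allocated to the machines, $n$ to each, by an allocation that may be random (for example uniform) or deterministic, but is independent of the data. Let $\hat\theta^{(j)}_n$ be the estimator $\hat\theta_n$ computed from the $n$ observations of machine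 $j$, let $\bar\theta=\frac1m\sum_{j=1}^m\hat\theta^{(j)}_n$, and let $\hat\theta_N$ be the same estimator computed centrally from all $N$ observations. Assume: 1. $\hat\theta_n$ is consistent: $\hat\theta_n=\theta^*+o_P(1)$. 2. $R$ admits a second-order Taylor expansion at $\theta^*$ with a (symmetric) nonsingular Hessian. 3. $\theta\mapsto f(Z,\theta)$ is differentiable at $\theta^*$, almost surely or in probability, with gradient $\nabla f(Z,\theta^*)$. (In probability means that $\big(f(Z,\theta^*+h)-f(Z,\theta^*)-\langle\nabla f(Z,\theta^*),h\rangle\big)/\|h\|\to0$ in probability as $h\to0$, $h\neq0$, for a random vector $\nabla f(Z,\theta^*)$.) 4. There are a neighbourhood of $\theta^*$ and a measurable $M$ with $\mathbb E[M(Z)^2]<\infty$ such that, almost surely, $|f(Z,\theta_1)-f(Z,\theta_2)|\le M(Z)\,\|\theta_1-\theta_2\|$ for all $\theta_1,\theta_2\in\Theta$ in this neighbourhood. 5. $\nabla f(Z,\theta^*)$ is not almost surely zero. Then, for every norm $\|\cdot\|$ on $\mathbb R^p$, as $n\to\infty$, $$\frac{\|\bar\theta-\theta^*\|}{\|\hat\theta_N-\theta^*\|}=1+o_P(1).$$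 Moreover $\bar\theta$ and $\hat\theta_N$ are first-order equivalent, at rate $N^{-1/2}$: there are random vectors $L_n,L_n'$ (the leading error terms) with $\bar\theta-\theta^*=L_n+o_P(N^{-1/2})$ and $\hat\theta_N-\theta^*=L'_n+o_P(N^{-1/2})$ such that $\sqrt N\,L_n$ and $\sqrt N\,L_n'$ converge in distribution to the same limit law, which is not the point mass at $0$. -/

import Mathlib

open Filter Topology MeasureTheory ProbabilityTheory
open scoped ENNReal

namespace SplitAverage

/-- The parameter space `ℝ^p`. -/
abbrev Param (p : ℕ) : Type := EuclideanSpace ℝ (Fin p)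

/-- The population risk `R(θ) = E f(Z, θ)` of a nonnegative loss `f`, where `Z` has law `P`.
It takes values in `[0, ∞]`. -/
noncomputable def risk {p : ℕ} {𝒵 : Type*} [MeasurableSpace 𝒵] (P : Measure 𝒵)
    (f : 𝒵 → Param p → ℝ) (θ : Param p) : ℝ≥0∞ :=
  ∫⁻ z, ENNReal.ofReal (f z θ) ∂P

/-- The empirical risk `(1/n) ∑ f(z_i, θ)` of the sample `z = (z_1, …, z_n)`. -/
noncomputable def empRisk {p : ℕ} {𝒵 : Type*} (f : 𝒵 → Param p → ℝ) {n : ℕ}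
    (z : Fin n → 𝒵) (θ : Param p) : ℝ :=
  (n : ℝ)⁻¹ * ∑ i, f (z i) θ

/-- The learning problem: an open convex parameter set `Θ ⊆ ℝ^p`, a loss `f : 𝒵 × Θ → [0, ∞)`
measurable in the observation, and a point `θs ∈ Θ` that is the unique minimizer over `Θ` of the
population risk. Values of `f` outside `Θ` are irrelevant. -/
structure IsLearningProblem {p : ℕ} {𝒵 : Type*} [MeasurableSpace 𝒵] (P : Measure 𝒵)
    (Θ : Set (Param p)) (f : 𝒵 → Param p → ℝ) (θs : Param p) : Prop where
  isOpen : IsOpen Θ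
  convex : Convex ℝ Θ
  nonneg : ∀ z, ∀ θ ∈ Θ, 0 ≤ f z θ
  measurable : ∀ θ ∈ Θ, Measurable fun z => f z θ
  mem : θs ∈ Θ
  unique_min : ∀ θ ∈ Θ, θ ≠ θs → risk P f θs < risk P f θ

/-- `T n` is an M-estimator based on `n` observations: a statistic that lies in `Θ` and minimizes
the empirical risk over `Θ` up to `o_P(1/n)` when the sample is i.i.d. with law `P`. Exact
minimizers are the case in which the probabilities below vanish. -/
structure IsMEstimator {p : ℕ} {𝒵 : Type*} [MeasurableSpace 𝒵] (P : Measure 𝒵)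
    (Θ : Set (Param p)) (f : 𝒵 → Param p → ℝ) (T : ∀ n : ℕ, (Fin n → 𝒵) → Param p) : Prop where
  aemeasurable : ∀ n, AEMeasurable (T n) (Measure.pi fun _ : Fin n => P)
  minimizes : ∀ ε : ℝ, 0 < ε → Tendsto
    (fun n : ℕ => (Measure.pi fun _ : Fin n => P)
      {z | ¬ (T n z ∈ Θ ∧ ∀ θ ∈ Θ, empRisk f z (T n z) ≤ empRisk f z θ + ε / n)})
    atTop (𝓝 0)

/-- `T n` converges in probability to `θs` under i.i.d. sampling from `P`. -/
def IsConsistent {p : ℕ} {𝒵 : Type*} [MeasurableSpace 𝒵] (P : Measure 𝒵)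
    (θs : Param p) (T : ∀ n : ℕ, (Fin n → 𝒵) → Param p) : Prop :=
  ∀ ε : ℝ, 0 < ε → Tendsto
    (fun n : ℕ => (Measure.pi fun _ : Fin n => P) {z | ε ≤ ‖T n z - θs‖}) atTop (𝓝 0)

/-- `R` admits a second order Taylor expansion at `θs`,
`R(θs + h) = R(θs) + ⟨b, h⟩ + ½ ⟨h, V h⟩ + o(‖h‖²)`, with symmetric nonsingular Hessian `V`. -/
def HasNonsingularTaylor {p : ℕ} (R : Param p → ℝ) (θs : Param p) : Prop :=
  ∃ (b : Param p) (V : Param p →L[ℝ] Param p), IsSelfAdjoint V ∧ IsUnit V ∧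
    (fun h : Param p => R (θs + h) - R θs - inner ℝ b h - (1 / 2) * inner ℝ h (V h))
      =o[𝓝 0] fun h => ‖h‖ ^ 2

/-- `θ ↦ f(Z, θ)` is differentiable at `θs` with gradient `ψ(Z)`, almost surely. -/
def HasGradientAS {p : ℕ} {𝒵 : Type*} [MeasurableSpace 𝒵] (P : Measure 𝒵)
    (f : 𝒵 → Param p → ℝ) (θs : Param p) (ψ : 𝒵 → Param p) : Prop :=
  ∀ᵐ z ∂P, HasGradientAt (f z) (ψ z) θs

/-- `θ ↦ f(Z, θ)` is differentiable at `θs` with gradient `ψ(Z)`, in probability: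
`(f(Z, θs + h) - f(Z, θs) - ⟨ψ(Z), h⟩) / ‖h‖ → 0` in probability as `h → 0`, `h ≠ 0`. -/
def HasGradientInProb {p : ℕ} {𝒵 : Type*} [MeasurableSpace 𝒵] (P : Measure 𝒵)
    (f : 𝒵 → Param p → ℝ) (θs : Param p) (ψ : 𝒵 → Param p) : Prop :=
  AEMeasurable ψ P ∧
  TendstoInMeasure P
    (fun (h : Param p) z => (f z (θs + h) - f z θs - inner ℝ (ψ z) h) / ‖h‖)
    (𝓝[≠] 0) (fun _ => 0)

/-- `f(Z, ·)` is Lipschitz near `θs`, with a square integrable Lipschitz coefficient `M(Z)`. -/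
def IsLipschitzNear {p : ℕ} {𝒵 : Type*} [MeasurableSpace 𝒵] (P : Measure 𝒵)
    (Θ : Set (Param p)) (f : 𝒵 → Param p → ℝ) (θs : Param p) : Prop :=
  ∃ r : ℝ, 0 < r ∧ ∃ M : 𝒵 → ℝ, MemLp M 2 P ∧
    ∀ᵐ z ∂P, ∀ θ₁ ∈ Metric.ball θs r ∩ Θ, ∀ θ₂ ∈ Metric.ball θs r ∩ Θ,
      |f z θ₁ - f z θ₂| ≤ M z * ‖θ₁ - θ₂‖

/-- The first order regularity assumptions. `ψ` is the gradient of the loss at `θs`. -/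
structure FirstOrderAssumptions {p : ℕ} {𝒵 : Type*} [MeasurableSpace 𝒵] (P : Measure 𝒵)
    (Θ : Set (Param p)) (f : 𝒵 → Param p → ℝ) (θs : Param p) (ψ : 𝒵 → Param p)
    (T : ∀ n : ℕ, (Fin n → 𝒵) → Param p) : Prop where
  consistent : IsConsistent P θs T
  taylor : HasNonsingularTaylor (fun θ => (risk P f θ).toReal) θs
  differentiable : HasGradientAS P f θs ψ ∨ HasGradientInProb P f θs ψ
  lipschitz : IsLipschitzNear P Θ f θs

/-- `A n` allocates the first `m * n` observations to `m` machines, `n` to each; it may be random,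
with any law (uniform, deterministic, …), but is independent of the data. -/
structure IsAllocation {Ω 𝒵 : Type*} [MeasurableSpace Ω] [MeasurableSpace 𝒵] (μ : Measure Ω)
    (Z : ℕ → Ω → 𝒵) (m : ℕ) (A : ∀ n : ℕ, Ω → (Fin m × Fin n ≃ Fin (m * n))) : Prop where
  measurable : ∀ n, Measurable[_, ⊤] (A n)
  indep : ∀ n, Indep (MeasurableSpace.comap (A n) ⊤)
    (MeasurableSpace.comap (fun ω (i : ℕ) => Z i ω) inferInstance) μ

/-- The M-estimator computed by a single center from the first `N` observations. -/
def centralized {p : ℕ} {Ω 𝒵 : Type*} (T : ∀ n : ℕ, (Fin n → 𝒵) → Param p) (Z : ℕ → Ω → 𝒵)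
    (N : ℕ) (ω : Ω) : Param p :=
  T N fun i => Z i ω

/-- The M-estimator computed by machine `j` from the `n` observations allocated to it. -/
def machine {p : ℕ} {Ω 𝒵 : Type*} (T : ∀ n : ℕ, (Fin n → 𝒵) → Param p) (Z : ℕ → Ω → 𝒵)
    {m : ℕ} (A : ∀ n : ℕ, Ω → (Fin m × Fin n ≃ Fin (m * n))) (j : Fin m) (n : ℕ) (ω : Ω) :
    Param p :=
  T n fun i => Z (A n ω (j, i)) ω

/-- The average of the `m` machine-wise estimators. -/
noncomputable def averaged {p : ℕ} {Ω 𝒵 : Type*} (T : ∀ n : ℕ, (Fin n → 𝒵) → Param p)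
    (Z : ℕ → Ω → 𝒵) {m : ℕ} (A : ∀ n : ℕ, Ω → (Fin m × Fin n ≃ Fin (m * n))) (n : ℕ) (ω : Ω) :
    Param p :=
  (m : ℝ)⁻¹ • ∑ j, machine T Z A j n ω

/-- `L n` is a leading term of the error `U n - θs` at rate `1 / a n`, with limiting law `ν`:
`U n - θs = L n + o_P(1 / a n)` and `a n • L n` converges in distribution to `ν ≠ δ₀`. -/
structure IsLeadingErrorTerm {p : ℕ} {Ω : Type*} [MeasurableSpace Ω] (μ : Measure Ω)
    [IsProbabilityMeasure μ] (θs : Param p) (a : ℕ → ℝ) (U L : ℕ → Ω → Param p)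
    (ν : Measure (Param p)) [IsProbabilityMeasure ν] : Prop where
  remainder : TendstoInMeasure μ (fun n ω => a n • (U n ω - θs - L n ω)) atTop (fun _ => 0)
  limit : TendstoInDistribution (fun n ω => a n • L n ω) atTop (id : Param p → Param p)
    (fun _ => μ) ν
  nondegenerate : ν ≠ Measure.dirac 0

/-- First order equivalence of the estimators `U n` and `W n` of `θs`, at rate `1 / a n → 0`:
their leading error terms converge to zero at this same rate, with the same limiting
distribution. -/
def FirstOrderEquivalent {p : ℕ} {Ω : Type*} [MeasurableSpace Ω] (μ : Measure Ω)
    [IsProbabilityMeasure μ] (θs : Param p) (a : ℕ → ℝ) (U W : ℕ → Ω → Param p) : Prop :=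
  Tendsto a atTop atTop ∧
  ∃ (L L' : ℕ → Ω → Param p) (ν : Measure (Param p)) (_ : IsProbabilityMeasure ν),
    IsLeadingErrorTerm μ θs a U L ν ∧ IsLeadingErrorTerm μ θs a W L' ν

end SplitAverage

/-!
The theorem rests on the asymptotic linearity of the M-estimator: for a sample of size `n`,
`√n (θ̂ - θ*) = n^{-1/2} ∑ φ(z_i) + o_P(1)` with `φ = -V⁻¹ ψ`, where `V` is the Hessian of the risk
and `ψ` the gradient of the loss at `θ*`. Granted this (`exists_asymptoticallyLinear`), every
observation belongs to exactly one machine, so the linear terms of the machines add up to the linear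
term of the centralized estimator: after multiplication by `√(m n)`, both estimation errors equal
`(m n)^{-1/2} ∑ φ(Z_i)` up to `o_P(1)`. The function `φ` is centred, because `θ*` minimizes the
risk, and it is square integrable and not almost surely zero. By the central limit theorem
(`tendstoInDistribution_sum`) the common leading term converges to a nonzero Gaussian law. This law
has no atom at `0`, so the leading term stays away from `0` and the ratio of the two errors tends to
one in any norm (`tendstoInMeasure_seminorm_div`). The sample of a single machine has the law of an
i.i.d. sample, since the allocation is independent of the data (`measure_allocated_mem_le`).

For the asymptotic linearity, differentiability of the loss, almost surely or in probability, and
the Lipschitz condition give differentiability in quadratic mean at `θ*`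
(`HasSubseqGradient.tendsto_quadraticMean`). The fluctuations of the empirical risk are controlled
by a maximal inequality for families of functions with a square integrable Lipschitz coefficient
`M`. With high probability no observation has `M > √n`, and truncation at this level makes the
increments of the empirical process sub-exponential, uniformly in `n`
(`measure_lt_abs_empProc_le`); since the index set is finite-dimensional, chaining along dyadic
grids then suffices
(`IsLipFamily.measure_exists_lt_abs_empProc_le`, `tendsto_measure_exists_lt_abs_empProc`). Peeling
into dyadic shells around `θ*` gives the rate `n^{-1/2}` (`IsLocalModel.exists_rate`). On balls of
radius `K n^{-1/2}` the empirical excess loss, summed over the sample, is uniformly within `o_P(1)`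
of a quadratic function (`IsLocalModel.tendsto_measure_quadratic`), and comparing the estimator with
the minimizer of that quadratic function gives the linear term
(`IsLocalModel.asymptoticallyLinear`).
-/

namespace SplitAverage

/-! ### Dyadic grids and chaining -/

/-- The points of the unit cube `[-1, 1]^p` whose coordinates are multiples of `2⁻ᵏ`. -/
noncomputable def grid (p k : ℕ) : Finset (Param p) :=
  (Fintype.piFinset fun _ : Fin p => Finset.Icc (-2 ^ k : ℤ) (2 ^ k)).image
    fun a => WithLp.toLp 2 fun i => (a i : ℝ) / 2 ^ k

/-- Coordinatewise rounding down to a multiple of `2⁻ᵏ`. -/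
noncomputable def gridRound {p : ℕ} (k : ℕ) (u : Param p) : Param p :=
  WithLp.toLp 2 fun i => (⌊u i * 2 ^ k⌋ : ℝ) / 2 ^ k

lemma abs_apply_le_norm {p : ℕ} (u : Param p) (i : Fin p) : |u i| ≤ ‖u‖ := by
  simpa using PiLp.norm_apply_le u i

lemma norm_le_sqrt_mul {p : ℕ} {u : Param p} {c : ℝ} (hc : 0 ≤ c) (h : ∀ i, |u i| ≤ c) :
    ‖u‖ ≤ √p * c := by
  rw [EuclideanSpace.norm_eq]
  calc √(∑ i, ‖u i‖ ^ 2) ≤ √(∑ _i : Fin p, c ^ 2) := by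
        apply Real.sqrt_le_sqrt
        exact Finset.sum_le_sum fun i _ => pow_le_pow_left₀ (norm_nonneg _) (h i) 2
    _ = √p * c := by
        simp [Real.sqrt_mul, Real.sqrt_sq hc]

lemma gridRound_mem {p : ℕ} (k : ℕ) {u : Param p} (hu : ‖u‖ ≤ 1) : gridRound k u ∈ grid p k := by
  refine Finset.mem_image.2 ⟨fun i => ⌊u i * 2 ^ k⌋, ?_, rfl⟩
  refine Fintype.mem_piFinset.2 fun i => Finset.mem_Icc.2 ?_
  have h := abs_le.1 ((abs_apply_le_norm u i).trans hu)
  have h2 : (0 : ℝ) < 2 ^ k := by positivity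
  constructor
  · apply Int.le_floor.2
    push_cast
    nlinarith
  · have : (⌊u i * 2 ^ k⌋ : ℝ) ≤ 2 ^ k := (Int.floor_le _).trans (by nlinarith)
    exact_mod_cast this

lemma norm_sub_gridRound_le {p : ℕ} (k : ℕ) (u : Param p) :
    ‖u - gridRound k u‖ ≤ √p * (1 / 2 ^ k) := by
  refine norm_le_sqrt_mul (by positivity) fun i => ?_
  have h2 : (0 : ℝ) < 2 ^ k := by positivity
  have h1 := Int.floor_le (u i * 2 ^ k)
  have h3 := Int.lt_floor_add_one (u i * 2 ^ k)
  have : (u - gridRound k u) i = (u i * 2 ^ k - ⌊u i * 2 ^ k⌋) / 2 ^ k := by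
    change u i - (⌊u i * 2 ^ k⌋ : ℝ) / 2 ^ k = _
    field_simp
  rw [this, abs_div, abs_of_pos h2]
  gcongr
  rw [abs_le]
  constructor <;> linarith

lemma norm_le_of_mem_grid {p k : ℕ} {a : Param p} (ha : a ∈ grid p k) : ‖a‖ ≤ √p := by
  obtain ⟨b, hb, rfl⟩ := Finset.mem_image.1 ha
  refine (norm_le_sqrt_mul zero_le_one fun i => ?_).trans_eq (mul_one _)
  have h2 : (0 : ℝ) < 2 ^ k := by positivity
  have := Finset.mem_Icc.1 (Fintype.mem_piFinset.1 hb i)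
  have h3 : (-2 ^ k : ℝ) ≤ b i := by exact_mod_cast this.1
  have h4 : (b i : ℝ) ≤ 2 ^ k := by exact_mod_cast this.2
  change |(b i : ℝ) / 2 ^ k| ≤ 1
  rw [abs_div, abs_of_pos h2, div_le_one h2, abs_le]
  exact ⟨h3, h4⟩

lemma zero_mem_grid (p k : ℕ) : (0 : Param p) ∈ grid p k := by
  refine Finset.mem_image.2 ⟨0, ?_, ?_⟩
  · exact Fintype.mem_piFinset.2 fun i => by simp
  · ext i
    simp

lemma card_grid_le (p k : ℕ) : (grid p k).card ≤ 2 ^ ((k + 2) * p) := by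
  refine Finset.card_image_le.trans ?_
  rw [Fintype.card_piFinset, Finset.prod_const, Finset.card_univ, Fintype.card_fin, Int.card_Icc,
    pow_mul]
  refine Nat.pow_le_pow_left ?_ p
  have : (1 : ℤ) ≤ 2 ^ k := one_le_pow₀ (by norm_num)
  have h2 : ((2 ^ (k + 2) : ℕ) : ℤ) = 4 * 2 ^ k := by push_cast; ring
  omega

/-- The rate at which the thresholds for the increments of a process between consecutive grids
grow with the level. It is large enough to outweigh the number of increments. -/
def chainSlope (p : ℕ) : ℝ := 2 * (5 * p + 1)

lemma chainSlope_nonneg (p : ℕ) : 0 ≤ chainSlope p := by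
  unfold chainSlope; positivity

/-- All increments of `x` between consecutive grids are controlled, at level `t`. -/
def ChainBound (p : ℕ) (t : ℝ) (x : Param p → ℝ) : Prop :=
  ∀ k : ℕ, ∀ a ∈ grid p k, ∀ b ∈ grid p (k + 1),
    |x a - x b| ≤ (t + chainSlope p * (k + 1)) * ‖a - b‖

lemma card_mul_exp_le (p k : ℕ) :
    ((grid p k).card * (grid p (k + 1)).card : ℝ) * Real.exp (-(chainSlope p * (k + 1)) / 2) ≤
      (1 / 2) ^ (k + 1) := by
  have h1 : ((grid p k).card * (grid p (k + 1)).card : ℝ) ≤ 2 ^ (5 * p * (k + 1)) := by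
    have : (grid p k).card * (grid p (k + 1)).card ≤ 2 ^ (5 * p * (k + 1)) := by
      calc _ ≤ 2 ^ ((k + 2) * p) * 2 ^ ((k + 1 + 2) * p) :=
            Nat.mul_le_mul (card_grid_le _ _) (card_grid_le _ _)
        _ = 2 ^ ((2 * k + 5) * p) := by rw [← pow_add]; congr 1; ring
        _ ≤ _ := Nat.pow_le_pow_right (by norm_num) (by nlinarith [Nat.zero_le (p * k)])
    exact_mod_cast this
  have h2 : Real.exp (-(chainSlope p * (k + 1)) / 2) ≤ (1 / 2) ^ ((5 * p + 1) * (k + 1)) := by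
    have : -(chainSlope p * (k + 1)) / 2 = (((5 * p + 1) * (k + 1) : ℕ) : ℝ) * (-1) := by
      unfold chainSlope; push_cast; ring
    rw [this, Real.exp_nat_mul]
    refine pow_le_pow_left₀ (Real.exp_pos _).le ?_ _
    rw [Real.exp_neg, one_div]
    exact inv_anti₀ (by norm_num) (by linarith [Real.add_one_le_exp 1])
  calc _ ≤ (2 : ℝ) ^ (5 * p * (k + 1)) * (1 / 2) ^ ((5 * p + 1) * (k + 1)) := by gcongr
    _ = (1 / 2) ^ (k + 1) := by
      rw [add_mul, one_mul, pow_add, ← mul_assoc, ← mul_pow]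
      norm_num

/-- Sub-exponential increments make `ChainBound` likely: a union bound over all grid levels. -/
lemma measure_not_chainBound_le {p : ℕ} {Ω : Type*} [MeasurableSpace Ω] {μ : Measure Ω}
    {X : Param p → Ω → ℝ} {C : ℝ} (hC : 0 ≤ C)
    (hX : ∀ a b : Param p, ‖a‖ ≤ √p → ‖b‖ ≤ √p → a ≠ b → ∀ t : ℝ, 0 ≤ t →
      μ {ω | t * ‖a - b‖ < |X a ω - X b ω|} ≤ ENNReal.ofReal (C * Real.exp (-t / 2)))
    {t : ℝ} (ht : 0 ≤ t) :
    μ {ω | ¬ ChainBound p t fun u => X u ω} ≤ ENNReal.ofReal (C * Real.exp (-t / 2)) := by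
  have key : ∀ k : ℕ, μ (⋃ ab ∈ grid p k ×ˢ grid p (k + 1), {ω | (t + chainSlope p * (k + 1)) *
      ‖ab.1 - ab.2‖ < |X ab.1 ω - X ab.2 ω|}) ≤
      ENNReal.ofReal (C * Real.exp (-t / 2) * (1 / 2) ^ (k + 1)) := by
    intro k
    have hs : 0 ≤ chainSlope p * (k + 1) := mul_nonneg (chainSlope_nonneg p) (by positivity)
    calc _ ≤ ∑ ab ∈ grid p k ×ˢ grid p (k + 1), μ {ω | (t + chainSlope p * (k + 1)) *
          ‖ab.1 - ab.2‖ < |X ab.1 ω - X ab.2 ω|} := measure_biUnion_finset_le _ _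
      _ ≤ ∑ ab ∈ grid p k ×ˢ grid p (k + 1),
          ENNReal.ofReal (C * Real.exp (-(t + chainSlope p * (k + 1)) / 2)) := by
        refine Finset.sum_le_sum fun ab hab => ?_
        rw [Finset.mem_product] at hab
        by_cases h : ab.1 = ab.2
        · simp [h]
        · exact hX _ _ (norm_le_of_mem_grid hab.1) (norm_le_of_mem_grid hab.2) h _ (by linarith)
      _ = ENNReal.ofReal (C * Real.exp (-t / 2) * (((grid p k).card * (grid p (k + 1)).card : ℝ) *
          Real.exp (-(chainSlope p * (k + 1)) / 2))) := by
        rw [Finset.sum_const, Finset.card_product, nsmul_eq_mul, ← ENNReal.ofReal_natCast,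
          ← ENNReal.ofReal_mul (by positivity)]
        congr 1
        have : -(t + chainSlope p * (k + 1)) / 2 = -t / 2 + -(chainSlope p * (k + 1)) / 2 := by ring
        rw [this, Real.exp_add]
        push_cast
        ring
      _ ≤ _ := by
        apply ENNReal.ofReal_le_ofReal
        gcongr
        exact card_mul_exp_le p k
  have hsub : {ω | ¬ ChainBound p t fun u => X u ω} ⊆
      ⋃ k : ℕ, ⋃ ab ∈ grid p k ×ˢ grid p (k + 1), {ω | (t + chainSlope p * (k + 1)) *
      ‖ab.1 - ab.2‖ < |X ab.1 ω - X ab.2 ω|} := by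
    intro ω hω
    simp only [ChainBound, Set.mem_ofPred_eq, not_forall, not_le] at hω
    obtain ⟨k, a, ha, b, hb, h⟩ := hω
    simp only [Set.mem_iUnion]
    exact ⟨k, (a, b), Finset.mem_product.2 ⟨ha, hb⟩, h⟩
  have hsum : HasSum (fun k : ℕ => C * Real.exp (-t / 2) * (1 / 2 : ℝ) ^ (k + 1))
      (C * Real.exp (-t / 2)) := by
    have := (hasSum_geometric_two.mul_left (1 / 2 : ℝ)).mul_left (C * Real.exp (-t / 2))
    simpa [pow_succ'] using this
  calc _ ≤ _ := measure_mono hsub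
    _ ≤ _ := measure_iUnion_le _
    _ ≤ ∑' k : ℕ, ENNReal.ofReal (C * Real.exp (-t / 2) * (1 / 2) ^ (k + 1)) :=
      ENNReal.tsum_le_tsum key
    _ = _ := by
      rw [← ENNReal.ofReal_tsum_of_nonneg (fun k => by positivity) hsum.summable, hsum.tsum_eq]

/-- Chaining: summing the increments along the successive roundings of a point. -/
lemma ChainBound.abs_sub_gridRound_le {p : ℕ} {t : ℝ} (ht : 0 ≤ t) {x : Param p → ℝ}
    (hx : ChainBound p t x) {u : Param p} (hu : ‖u‖ ≤ 1) (hc : ContinuousAt x u) (k₀ : ℕ) :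
    |x u - x (gridRound k₀ u)| ≤ 4 * √p * (t + chainSlope p * (k₀ + 2)) / 2 ^ k₀ := by
  set a := chainSlope p
  have ha : 0 ≤ a := chainSlope_nonneg p
  -- `β` is the tail of the series of the increment bounds
  let β : ℕ → ℝ := fun k => 4 * √p * (t + a * (k + 2)) / 2 ^ k
  have hβ : ∀ k, β k - β (k + 1) = (t + a * (k + 1)) * (2 * √p * (1 / 2 ^ k)) := by
    intro k
    simp only [β]
    push_cast
    field_simp
    ring
  have hstep : ∀ k, |x (gridRound k u) - x (gridRound (k + 1) u)| ≤ β k - β (k + 1) := by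
    intro k
    have h0 : 0 ≤ t + a * (k + 1) := by positivity
    rw [hβ]
    refine (hx k _ (gridRound_mem k hu) _ (gridRound_mem (k + 1) hu)).trans ?_
    refine mul_le_mul_of_nonneg_left ?_ h0
    have h1 := norm_sub_gridRound_le k u
    have h2 := norm_sub_gridRound_le (k + 1) u
    have h3 : √p * (1 / 2 ^ (k + 1)) ≤ √p * (1 / 2 ^ k) := by
      gcongr <;> norm_num
    have h4 : gridRound k u - gridRound (k + 1) u =
      (u - gridRound (k + 1) u) - (u - gridRound k u) := by abel
    rw [h4]
    linarith [norm_sub_le (u - gridRound (k + 1) u) (u - gridRound k u)]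
  have hsum : ∀ j, |x (gridRound (k₀ + j) u) - x (gridRound k₀ u)| ≤ β k₀ := by
    intro j
    have : |x (gridRound (k₀ + j) u) - x (gridRound k₀ u)| ≤ β k₀ - β (k₀ + j) := by
      induction j with
      | zero => simp
      | succ j ih =>
        have h := hstep (k₀ + j)
        rw [abs_sub_comm] at h
        have := abs_add_le (x (gridRound (k₀ + j + 1) u) - x (gridRound (k₀ + j) u))
          (x (gridRound (k₀ + j) u) - x (gridRound k₀ u))
        rw [sub_add_sub_cancel] at this
        rw [← add_assoc]
        linarith
    have h0 : 0 ≤ β (k₀ + j) := by positivity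
    linarith
  have hlim : Tendsto (fun j => gridRound (k₀ + j) u) atTop (𝓝 u) := by
    rw [tendsto_iff_norm_sub_tendsto_zero]
    have h0 : Tendsto (fun j : ℕ => √p * (1 / 2 ^ (k₀ + j))) atTop (𝓝 0) := by
      have := ((tendsto_pow_atTop_nhds_zero_of_lt_one (r := (1 / 2 : ℝ)) (by norm_num)
        (by norm_num)).comp (tendsto_add_atTop_nat k₀)).const_mul √p
      simpa [Function.comp_def, add_comm] using this
    refine squeeze_zero (fun _ => norm_nonneg _) (fun j => ?_) h0
    rw [norm_sub_rev]
    exact norm_sub_gridRound_le _ _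
  have := ((hc.tendsto.comp hlim).sub_const (x (gridRound k₀ u))).abs
  exact le_of_tendsto' this hsum

/-- The uniform bound over the unit ball that chaining gives. -/
lemma ChainBound.abs_sub_zero_le {p : ℕ} {t : ℝ} (ht : 0 ≤ t) {x : Param p → ℝ}
    (hx : ChainBound p t x) {u : Param p} (hu : ‖u‖ ≤ 1) (hc : ContinuousAt x u) :
    |x u - x 0| ≤ √p * (5 + 9 * chainSlope p) * (t + 1) := by
  have h1 := hx.abs_sub_gridRound_le ht hu hc 0
  have h2 := hx 0 _ (gridRound_mem 0 hu) 0 (zero_mem_grid _ _)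
  have h3 : ‖gridRound 0 u - 0‖ ≤ √p := by
    rw [sub_zero]; exact norm_le_of_mem_grid (gridRound_mem 0 hu)
  have ha := chainSlope_nonneg p
  have h4 : (t + chainSlope p * ((0 : ℕ) + 1)) * ‖gridRound 0 u - 0‖ ≤
      (t + chainSlope p * ((0 : ℕ) + 1)) * √p := by gcongr
  have h5 := abs_add_le (x u - x (gridRound 0 u)) (x (gridRound 0 u) - x 0)
  rw [sub_add_sub_cancel] at h5
  have h6 : 0 ≤ √(p : ℝ) * (chainSlope p * t) := by positivity
  have h7 : 0 ≤ √(p : ℝ) := by positivity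
  simp only [pow_zero, div_one, CharP.cast_eq_zero, zero_add, mul_one] at h1 h2 h4
  nlinarith

/-! ### Sub-exponential tails of normalized sums -/

/-- The empirical process `n^{-1/2} ∑ (g(z_i) - E g)` at the function `g` and the sample `z`. -/
noncomputable def empProc {𝒵 : Type*} [MeasurableSpace 𝒵] (P : Measure 𝒵) (g : 𝒵 → ℝ) {n : ℕ}
    (z : Fin n → 𝒵) : ℝ :=
  (√n)⁻¹ * ∑ i, (g (z i) - ∫ y, g y ∂P)

section Tail

variable {𝒵 : Type*} [MeasurableSpace 𝒵] {P : Measure 𝒵} [IsProbabilityMeasure P]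

/-- Bound on the moment generating function at `1`, from `eʸ ≤ 1 + y + y²` for `|y| ≤ 1`. -/
lemma integral_exp_le_of_abs_le_one {Y : 𝒵 → ℝ} (hY : AEMeasurable Y P)
    (h1 : ∀ᵐ z ∂P, |Y z| ≤ 1) (h0 : ∫ z, Y z ∂P = 0) :
    ∫ z, Real.exp (Y z) ∂P ≤ Real.exp (∫ z, Y z ^ 2 ∂P) := by
  have hYi : Integrable Y P := .of_bound hY.aestronglyMeasurable 1 (by simpa using h1)
  have hY2 : Integrable (fun z => Y z ^ 2) P := by
    refine .of_bound (hY.pow_const 2).aestronglyMeasurable 1 ?_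
    filter_upwards [h1] with z hz
    simpa using hz
  have hb : ∀ᵐ z ∂P, Real.exp (Y z) ≤ 1 + Y z + Y z ^ 2 := by
    filter_upwards [h1] with z hz
    linarith [(abs_le.1 (Real.abs_exp_sub_one_sub_id_le hz)).2]
  have hexp : Integrable (fun z => Real.exp (Y z)) P := by
    refine .of_bound (Real.measurable_exp.comp_aemeasurable hY).aestronglyMeasurable
      (Real.exp 1) ?_
    filter_upwards [h1] with z hz
    rw [Real.norm_eq_abs, Real.abs_exp]
    exact Real.exp_le_exp.2 ((le_abs_self _).trans hz)
  have h1Y : Integrable (fun z => 1 + Y z) P := (integrable_const 1).add hYi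
  calc ∫ z, Real.exp (Y z) ∂P ≤ ∫ z, (1 + Y z + Y z ^ 2) ∂P :=
        integral_mono_ae hexp (h1Y.add hY2) hb
    _ = 1 + ∫ z, Y z ^ 2 ∂P := by
        rw [integral_add h1Y hY2,
          integral_add (integrable_const 1) hYi, h0]
        simp
    _ ≤ _ := by linarith [Real.add_one_le_exp (∫ z, Y z ^ 2 ∂P)]

/-- Chernoff's bound with exponent `1`. -/
lemma measure_le_sum_le {n : ℕ} {Y : 𝒵 → ℝ} (hY : AEMeasurable Y P)
    (h1 : ∀ᵐ z ∂P, |Y z| ≤ 1) (h0 : ∫ z, Y z ∂P = 0) {v : ℝ}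
    (hv : n * ∫ z, Y z ^ 2 ∂P ≤ v) (x : ℝ) :
    (Measure.pi fun _ : Fin n => P) {z | x ≤ ∑ i, Y (z i)} ≤
      ENNReal.ofReal (Real.exp (v - x)) := by
  set Q := Measure.pi fun _ : Fin n => P
  have hmp : ∀ i : Fin n, MeasurePreserving (fun z : Fin n → 𝒵 => z i) Q P := fun i =>
    measurePreserving_eval _ i
  have hYQ : ∀ i : Fin n, AEMeasurable (fun z : Fin n → 𝒵 => Y (z i)) Q := fun i =>
    hY.comp_quasiMeasurePreserving (hmp i).quasiMeasurePreserving
  have hind : iIndepFun (fun (i : Fin n) (z : Fin n → 𝒵) => Y (z i)) Q :=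
    iIndepFun_pi fun _ => hY
  have hbd : ∀ᵐ z ∂Q, ∀ i, |Y (z i)| ≤ 1 :=
    ae_all_iff.2 fun i => (hmp i).quasiMeasurePreserving.ae h1
  have hint : Integrable (fun z : Fin n → 𝒵 => Real.exp (1 * ∑ i, Y (z i))) Q := by
    refine .of_bound (Real.measurable_exp.comp_aemeasurable
      ((Finset.aemeasurable_fun_sum _ fun i _ => hYQ i).const_mul 1)).aestronglyMeasurable
      (Real.exp n) ?_
    filter_upwards [hbd] with z hz
    rw [Real.norm_eq_abs, Real.abs_exp]
    refine Real.exp_le_exp.2 ?_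
    rw [one_mul]
    calc ∑ i, Y (z i) ≤ ∑ _i : Fin n, (1 : ℝ) :=
          Finset.sum_le_sum fun i _ => (le_abs_self _).trans (hz i)
      _ = n := by simp
  have h := measure_ge_le_exp_mul_mgf (μ := Q) (X := fun z => ∑ i, Y (z i)) x zero_le_one hint
  have hm : mgf (fun z : Fin n → 𝒵 => ∑ i, Y (z i)) Q 1 ≤ Real.exp v := by
    have h2 := hind.mgf_sum₀ (t := 1) hYQ Finset.univ
    have h3 : (∑ i, fun z : Fin n → 𝒵 => Y (z i)) = fun z => ∑ i, Y (z i) := by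
      ext z; simp
    rw [h3] at h2
    rw [h2]
    have h4 : ∀ i : Fin n, mgf (fun z : Fin n → 𝒵 => Y (z i)) Q 1 ≤
        Real.exp (∫ z, Y z ^ 2 ∂P) := by
      intro i
      have h5 : AEStronglyMeasurable (fun y => Real.exp (Y y)) (Q.map fun z => z i) := by
        rw [(hmp i).map_eq]
        exact (Real.measurable_exp.comp_aemeasurable hY).aestronglyMeasurable
      simp only [mgf, one_mul]
      rw [← integral_map (hmp i).measurable.aemeasurable h5, (hmp i).map_eq]
      exact integral_exp_le_of_abs_le_one hY h1 h0
    refine (Finset.prod_le_prod (fun i _ => mgf_nonneg) fun i _ => h4 i).trans ?_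
    rw [Finset.prod_const, Finset.card_univ, Fintype.card_fin, ← Real.exp_nat_mul]
    exact Real.exp_le_exp.2 hv
  rw [← ofReal_measureReal]
  apply ENNReal.ofReal_le_ofReal
  refine h.trans ?_
  rw [sub_eq_neg_add, Real.exp_add, neg_one_mul]
  gcongr

/-- A normalized sum of `n` centred variables bounded by `√n d`, with second moment `s d²`, has
exponential tails at scale `d`. -/
lemma measure_lt_abs_empProc_le {n : ℕ} (hn : 0 < n) {φ : 𝒵 → ℝ} (hφ : AEMeasurable φ P)
    {d s : ℝ} (hd : 0 < d) (h1 : ∀ᵐ z ∂P, |φ z| ≤ √n * d) (h2 : ∫ z, φ z ^ 2 ∂P ≤ s * d ^ 2)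
    (t : ℝ) :
    (Measure.pi fun _ : Fin n => P) {z | t * d < |empProc P φ z|} ≤
      ENNReal.ofReal (2 * Real.exp (s / 4) * Real.exp (-t / 2)) := by
  have hn' : (0 : ℝ) < n := by exact_mod_cast hn
  have hsn : 0 < √(n : ℝ) := Real.sqrt_pos.2 hn'
  have hφi : Integrable φ P := .of_bound hφ.aestronglyMeasurable (√n * d) (by simpa using h1)
  have hφ2 : MemLp φ 2 P := .of_bound hφ.aestronglyMeasurable (√n * d) (by simpa using h1)
  set e := ∫ z, φ z ∂P
  have he : |e| ≤ √n * d := by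
    have := norm_integral_le_of_norm_le_const (μ := P) (f := φ) (by simpa using h1)
    simpa using this
  let Y : 𝒵 → ℝ := fun z => (φ z - e) / (2 * (√n * d))
  have hYm : AEMeasurable Y P := (hφ.sub_const e).div_const _
  have hY1 : ∀ᵐ z ∂P, |Y z| ≤ 1 := by
    filter_upwards [h1] with z hz
    simp only [Y]
    rw [abs_div, abs_of_pos (by positivity : 0 < 2 * (√n * d)), div_le_one (by positivity)]
    linarith [abs_sub (φ z) e]
  have hY0 : ∫ z, Y z ∂P = 0 := by
    simp only [Y]
    rw [integral_div, integral_sub hφi (integrable_const _)]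
    simp [e]
  have hY2 : n * ∫ z, Y z ^ 2 ∂P ≤ s / 4 := by
    have h3 : ∫ z, (φ z - e) ^ 2 ∂P ≤ s * d ^ 2 := by
      have h4 := variance_le_expectation_sq (μ := P) hφ2.aestronglyMeasurable
      rw [variance_eq_integral hφ] at h4
      exact h4.trans h2
    simp only [Y, div_pow]
    rw [integral_div, mul_pow, mul_pow, Real.sq_sqrt hn'.le]
    calc n * ((∫ z, (φ z - e) ^ 2 ∂P) / (2 ^ 2 * (n * d ^ 2)))
        ≤ n * ((s * d ^ 2) / (2 ^ 2 * (n * d ^ 2))) := by gcongr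
      _ = s / 4 := by field_simp; norm_num
  have hsum : ∀ z : Fin n → 𝒵, ∑ i, Y (z i) = empProc P φ z / (2 * d) := by
    intro z
    simp only [Y, empProc]
    rw [← Finset.sum_div]
    field_simp
    simp [e]
  have hneg : ∀ z : Fin n → 𝒵, ∑ i, -Y (z i) = -(empProc P φ z / (2 * d)) := by
    intro z
    rw [Finset.sum_neg_distrib, hsum]
  have hA := measure_le_sum_le (n := n) hYm hY1 hY0 hY2 (t / 2)
  have hB := measure_le_sum_le (n := n) (Y := fun z => -Y z) hYm.neg (by simpa using hY1)
    (by rw [integral_neg, hY0, neg_zero]) (v := s / 4) (by simpa using hY2) (t / 2)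
  have hsub : {z : Fin n → 𝒵 | t * d < |empProc P φ z|} ⊆
      {z | t / 2 ≤ ∑ i, Y (z i)} ∪ {z | t / 2 ≤ ∑ i, -Y (z i)} := by
    intro z hz
    have hz' : t * d < |empProc P φ z| := hz
    rw [Set.mem_union]
    change t / 2 ≤ ∑ i, Y (z i) ∨ t / 2 ≤ ∑ i, -Y (z i)
    rw [hsum, hneg, ← neg_div, le_div_iff₀ (by positivity), le_div_iff₀ (by positivity)]
    rcases lt_abs.1 hz' with h | h
    · left; linarith
    · right; linarith
  calc _ ≤ _ := measure_mono hsub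
    _ ≤ _ := measure_union_le _ _
    _ ≤ _ := add_le_add hA hB
    _ = _ := by
      rw [← ENNReal.ofReal_add (Real.exp_pos _).le (Real.exp_pos _).le]
      congr 1
      rw [show s / 4 - t / 2 = s / 4 + -t / 2 by ring, Real.exp_add]
      ring

/-- Chebyshev's inequality for the empirical process. -/
lemma measure_le_abs_empProc_le {n : ℕ} {φ : 𝒵 → ℝ} (hφ : MemLp φ 2 P) {c : ℝ} (hc : 0 < c) :
    (Measure.pi fun _ : Fin n => P) {z | c ≤ |empProc P φ z|} ≤
      ENNReal.ofReal ((∫ z, φ z ^ 2 ∂P) / c ^ 2) := by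
  rcases Nat.eq_zero_or_pos n with rfl | hn
  · simp [empProc, hc.not_ge]
  have hn' : (0 : ℝ) < n := by exact_mod_cast hn
  have hmp : ∀ i : Fin n, MeasurePreserving (fun z : Fin n → 𝒵 => z i)
    (Measure.pi fun _ : Fin n => P) P := fun i => measurePreserving_eval _ i
  set e := ∫ z, φ z ∂P
  have hmem : ∀ i : Fin n, MemLp (fun z : Fin n → 𝒵 => φ (z i)) 2
      (Measure.pi fun _ : Fin n => P) := fun i => hφ.comp_measurePreserving (hmp i)
  have hS : MemLp (∑ i, fun z : Fin n → 𝒵 => φ (z i)) 2 (Measure.pi fun _ : Fin n => P) :=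
    memLp_finsetSum' _ fun i _ => hmem i
  have hint : ∀ i : Fin n, ∫ z : Fin n → 𝒵, φ (z i) ∂(Measure.pi fun _ : Fin n => P) = e := by
    intro i
    have h5 : AEStronglyMeasurable φ ((Measure.pi fun _ : Fin n => P).map fun z => z i) := by
      rw [(hmp i).map_eq]; exact hφ.1
    rw [← integral_map (hmp i).measurable.aemeasurable h5, (hmp i).map_eq]
  have hE : ∫ z, (∑ i, fun z : Fin n → 𝒵 => φ (z i)) z ∂(Measure.pi fun _ : Fin n => P) =
      n * e := by
    simp only [Finset.sum_apply]
    rw [integral_finsetSum _ fun i _ => (hmem i).integrable one_le_two]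
    simp [hint]
  have hV : Var[∑ i, fun z : Fin n → 𝒵 => φ (z i); Measure.pi fun _ : Fin n => P] ≤
      n * ∫ z, φ z ^ 2 ∂P := by
    rw [variance_sum_pi (X := fun _ => φ) fun _ => hφ]
    simp only [Finset.sum_const, Finset.card_univ, Fintype.card_fin, nsmul_eq_mul]
    gcongr
    exact variance_le_expectation_sq hφ.1
  have h := meas_ge_le_variance_div_sq hS (c := √n * c) (by positivity)
  rw [hE] at h
  have hset : {z : Fin n → 𝒵 | c ≤ |empProc P φ z|} =
      {z | √n * c ≤ |(∑ i, fun z : Fin n → 𝒵 => φ (z i)) z - n * e|} := by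
    ext z
    change c ≤ |empProc P φ z| ↔ √n * c ≤ |(∑ i, fun z : Fin n → 𝒵 => φ (z i)) z - n * e|
    have : (∑ i, fun z : Fin n → 𝒵 => φ (z i)) z - n * e = √n * empProc P φ z := by
      simp only [empProc, Finset.sum_apply]
      rw [← mul_assoc, mul_inv_cancel₀ (by positivity), one_mul, Finset.sum_sub_distrib]
      simp [e]
    rw [this, abs_mul, abs_of_pos (by positivity : 0 < √(n : ℝ)),
      mul_le_mul_iff_right₀ (by positivity)]
  rw [hset]
  refine h.trans (ENNReal.ofReal_le_ofReal ?_)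
  rw [mul_pow, Real.sq_sqrt hn'.le]
  calc _ ≤ (n * ∫ z, φ z ^ 2 ∂P) / (n * c ^ 2) := by gcongr
    _ = _ := by field_simp

end Tail

/-! ### Maximal inequalities for Lipschitz families -/

/-- `g` is a family of functions on `𝒵`, indexed by the ball of radius `R` in `ℝ^p`, vanishing at
the index `0` and Lipschitz in the index, with square integrable Lipschitz coefficient `M`. -/
structure IsLipFamily {p : ℕ} {𝒵 : Type*} [MeasurableSpace 𝒵] (P : Measure 𝒵)
    (g : Param p → 𝒵 → ℝ) (M : 𝒵 → ℝ) (R : ℝ) : Prop where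
  aemeasurable : ∀ u, ‖u‖ < R → AEMeasurable (g u) P
  zero : ∀ z, g 0 z = 0
  measurable : Measurable M
  nonneg : ∀ z, 0 ≤ M z
  memLp : MemLp M 2 P
  lip : ∀ᵐ z ∂P, ∀ u v, ‖u‖ < R → ‖v‖ < R → |g u z - g v z| ≤ M z * ‖u - v‖

/-- The function `φ` truncated to the set where the Lipschitz coefficient `M` is at most `√n`. -/
noncomputable def trunc {𝒵 : Type*} (M : 𝒵 → ℝ) (n : ℕ) (φ : 𝒵 → ℝ) : 𝒵 → ℝ :=
  Set.indicator {z | M z ≤ √n} φ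

lemma trunc_of_le {𝒵 : Type*} {M : 𝒵 → ℝ} {n : ℕ} {φ : 𝒵 → ℝ} {z : 𝒵}
    (h : M z ≤ √n) : trunc M n φ z = φ z :=
  Set.indicator_of_mem (s := {z | M z ≤ √n}) h φ

lemma trunc_of_lt {𝒵 : Type*} {M : 𝒵 → ℝ} {n : ℕ} {φ : 𝒵 → ℝ} {z : 𝒵}
    (h : √n < M z) : trunc M n φ z = 0 :=
  Set.indicator_of_notMem (s := {z | M z ≤ √n}) h.not_ge φ

section Lip

variable {p : ℕ} {𝒵 : Type*} [MeasurableSpace 𝒵] {P : Measure 𝒵}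
  {g : Param p → 𝒵 → ℝ} {M : 𝒵 → ℝ} {R : ℝ}

/-- The part of the second moment of `M` above the truncation level `√n`. -/
noncomputable def tailSq (P : Measure 𝒵) (M : 𝒵 → ℝ) (n : ℕ) : ℝ :=
  ∫ z, Set.indicator {z | √n < M z} (fun z => M z ^ 2) z ∂P

lemma tailSq_le (hM : MemLp M 2 P) (n : ℕ) : tailSq P M n ≤ ∫ z, M z ^ 2 ∂P := by
  refine integral_mono_of_nonneg (ae_of_all _ fun z => ?_) hM.integrable_sq
    (ae_of_all _ fun z => ?_)
  · exact Set.indicator_nonneg (fun z _ => sq_nonneg _) z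
  · exact Set.indicator_le_self' (fun z _ => sq_nonneg _) z

lemma tendsto_tailSq (hMm : Measurable M) (hM : MemLp M 2 P) :
    Tendsto (tailSq P M) atTop (𝓝 0) := by
  have h : Tendsto (tailSq P M) atTop (𝓝 (∫ _z, (0 : ℝ) ∂P)) := by
    refine tendsto_integral_of_dominated_convergence (fun z => M z ^ 2) (fun n => ?_)
      hM.integrable_sq (fun n => ae_of_all _ fun z => ?_) (ae_of_all _ fun z => ?_)
    · exact ((hMm.pow_const 2).indicator
        (measurableSet_lt measurable_const hMm)).aestronglyMeasurable
    · rw [Real.norm_of_nonneg (Set.indicator_nonneg (fun z _ => sq_nonneg _) z)]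
      exact Set.indicator_le_self' (fun z _ => sq_nonneg _) z
    · have : ∀ᶠ n : ℕ in atTop, M z ≤ √n :=
        (Real.tendsto_sqrt_atTop.comp tendsto_natCast_atTop_atTop).eventually_ge_atTop (M z)
      refine tendsto_const_nhds.congr' ?_
      filter_upwards [this] with n hn
      exact (Set.indicator_of_notMem (s := {z | √n < M z}) hn.not_gt _).symm
  simpa using h

/-- With high probability no observation is truncated at level `√n`. -/
lemma measure_exists_lt_le [IsProbabilityMeasure P]
    (hMm : Measurable M) (hM : MemLp M 2 P) (n : ℕ) :
    (Measure.pi fun _ : Fin n => P) {z | ¬ ∀ i, M (z i) ≤ √n} ≤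
      ENNReal.ofReal (tailSq P M n) := by
  have hms : MeasurableSet {z | √n < M z} := measurableSet_lt measurable_const hMm
  have hsub : {z : Fin n → 𝒵 | ¬ ∀ i, M (z i) ≤ √n} ⊆
      ⋃ i, (fun z : Fin n → 𝒵 => z i) ⁻¹' {z | √n < M z} := by
    intro z hz
    have hz' : ¬ ∀ i, M (z i) ≤ √n := hz
    obtain ⟨i, hi⟩ := not_forall.1 hz'
    exact Set.mem_iUnion.2 ⟨i, not_le.1 hi⟩
  have h1 : n * P.real {z | √n < M z} ≤ tailSq P M n := by
    unfold tailSq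
    rw [integral_indicator hms]
    calc n * P.real {z | √n < M z} = ∫ z in {z | √n < M z}, (n : ℝ) ∂P := by
          simp [mul_comm]
      _ ≤ _ := by
        refine setIntegral_mono_on (integrable_const _) hM.integrable_sq.integrableOn hms
          fun z hz => ?_
        have hz' : √n < M z := hz
        calc (n : ℝ) = √n ^ 2 := (Real.sq_sqrt (Nat.cast_nonneg n)).symm
          _ ≤ _ := pow_le_pow_left₀ (Real.sqrt_nonneg _) hz'.le 2
  calc _ ≤ _ := measure_mono hsub
    _ ≤ _ := measure_iUnion_le _
    _ = ENNReal.ofReal (n * P.real {z | √n < M z}) := by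
      simp_rw [fun i : Fin n => (measurePreserving_eval (fun _ : Fin n => P) i).measure_preimage
        hms.nullMeasurableSet]
      rw [tsum_fintype, ENNReal.ofReal_mul (by positivity), ofReal_measureReal]
      simp
    _ ≤ _ := ENNReal.ofReal_le_ofReal h1

namespace IsLipFamily

lemma abs_le (hg : IsLipFamily P g M R) (hR : 0 < R) :
    ∀ᵐ z ∂P, ∀ u, ‖u‖ < R → |g u z| ≤ M z * ‖u‖ := by
  filter_upwards [hg.lip] with z hz u hu
  simpa [hg.zero] using hz u 0 hu (by simpa)

lemma memLp_apply (hg : IsLipFamily P g M R) {u : Param p} (hu : ‖u‖ < R) :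
    MemLp (g u) 2 P := by
  refine (hg.memLp.mul_const ‖u‖).mono (hg.aemeasurable u hu).aestronglyMeasurable ?_
  filter_upwards [hg.abs_le ((norm_nonneg u).trans_lt hu)] with z hz
  rw [Real.norm_eq_abs, Real.norm_eq_abs]
  exact (hz u hu).trans (le_abs_self _)

lemma aemeasurable_trunc (hg : IsLipFamily P g M R) (n : ℕ) {u : Param p} (hu : ‖u‖ < R) :
    AEMeasurable (trunc M n (g u)) P :=
  (hg.aemeasurable u hu).indicator (measurableSet_le hg.measurable measurable_const)

lemma memLp_trunc (hg : IsLipFamily P g M R) (n : ℕ) {u : Param p} (hu : ‖u‖ < R) :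
    MemLp (trunc M n (g u)) 2 P :=
  (hg.memLp_apply hu).indicator (measurableSet_le hg.measurable measurable_const)

lemma abs_trunc_sub_le (hg : IsLipFamily P g M R) (n : ℕ) :
    ∀ᵐ z ∂P, ∀ u v, ‖u‖ < R → ‖v‖ < R →
      |trunc M n (g u) z - trunc M n (g v) z| ≤ M z * ‖u - v‖ ∧
      |trunc M n (g u) z - trunc M n (g v) z| ≤ √n * ‖u - v‖ := by
  filter_upwards [hg.lip] with z hz u v hu hv
  rcases le_or_gt (M z) (√n) with h | h
  · rw [trunc_of_le h, trunc_of_le h]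
    exact ⟨hz u v hu hv, (hz u v hu hv).trans (by gcongr)⟩
  · rw [trunc_of_lt h, trunc_of_lt h, sub_zero, abs_zero]
    have := hg.nonneg z
    exact ⟨by positivity, by positivity⟩

lemma empProc_trunc_sub [IsProbabilityMeasure P]
    (hg : IsLipFamily P g M R) {n : ℕ} {u v : Param p} (hu : ‖u‖ < R)
    (hv : ‖v‖ < R) (z : Fin n → 𝒵) :
    empProc P (trunc M n (g u)) z - empProc P (trunc M n (g v)) z =
      empProc P (fun y => trunc M n (g u) y - trunc M n (g v) y) z := by
  unfold empProc
  rw [integral_sub ((hg.memLp_trunc n hu).integrable one_le_two)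
    ((hg.memLp_trunc n hv).integrable one_le_two), ← mul_sub, ← Finset.sum_sub_distrib]
  congr 1
  exact Finset.sum_congr rfl fun i _ => by ring

lemma measure_lt_abs_sub_le [IsProbabilityMeasure P]
    (hg : IsLipFamily P g M R) {n : ℕ} (hn : 0 < n) {a b : Param p}
    (ha : ‖a‖ < R) (hb : ‖b‖ < R) (hab : a ≠ b) (t : ℝ) :
    (Measure.pi fun _ : Fin n => P) {z | t * ‖a - b‖ <
      |empProc P (trunc M n (g a)) z - empProc P (trunc M n (g b)) z|} ≤
      ENNReal.ofReal (2 * Real.exp ((∫ z, M z ^ 2 ∂P) / 4) * Real.exp (-t / 2)) := by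
  simp_rw [hg.empProc_trunc_sub ha hb]
  refine measure_lt_abs_empProc_le hn
    ((hg.aemeasurable_trunc n ha).sub (hg.aemeasurable_trunc n hb))
    (norm_pos_iff.2 (sub_ne_zero.2 hab)) ?_ ?_ t
  · filter_upwards [hg.abs_trunc_sub_le n] with z hz
    exact (hz a b ha hb).2
  · rw [← integral_mul_const]
    refine integral_mono_of_nonneg (ae_of_all _ fun z => sq_nonneg _)
      (hg.memLp.integrable_sq.mul_const _) ?_
    filter_upwards [hg.abs_trunc_sub_le n] with z hz
    have h := (hz a b ha hb).1
    rw [← mul_pow, ← sq_abs]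
    exact pow_le_pow_left₀ (abs_nonneg _) h 2

lemma ae_continuousAt [IsProbabilityMeasure P]
    (hg : IsLipFamily P g M R) (n : ℕ) :
    ∀ᵐ z ∂(Measure.pi fun _ : Fin n => P), ∀ u, ‖u‖ < R →
      ContinuousAt (fun u => empProc P (trunc M n (g u)) z) u := by
  have h1 : ∀ᵐ z ∂(Measure.pi fun _ : Fin n => P), ∀ i, ∀ u v, ‖u‖ < R → ‖v‖ < R →
      |trunc M n (g u) (z i) - trunc M n (g v) (z i)| ≤ √n * ‖u - v‖ := by
    refine ae_all_iff.2 fun i => ?_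
    have h2 := (measurePreserving_eval (fun _ : Fin n => P) i).quasiMeasurePreserving.ae
      (hg.abs_trunc_sub_le n)
    filter_upwards [h2] with z hz u v hu hv
    exact (hz u v hu hv).2
  filter_upwards [h1] with z hz u hu
  have hint : ∀ u v, ‖u‖ < R → ‖v‖ < R →
      |∫ y, (trunc M n (g u) y - trunc M n (g v) y) ∂P| ≤ √n * ‖u - v‖ := by
    intro u v hu hv
    have := norm_integral_le_of_norm_le_const (μ := P)
      (f := fun y => trunc M n (g u) y - trunc M n (g v) y) (C := √n * ‖u - v‖) (by
        filter_upwards [hg.abs_trunc_sub_le n] with z hz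
        exact (hz u v hu hv).2)
    simpa using this
  have hlip : LipschitzOnWith (Real.toNNReal ((√n)⁻¹ * (n * (2 * √n))))
      (fun u => empProc P (trunc M n (g u)) z) (Metric.ball 0 R) := by
    refine LipschitzOnWith.of_dist_le_mul fun u hu v hv => ?_
    rw [mem_ball_zero_iff] at hu hv
    rw [Real.dist_eq, dist_eq_norm, hg.empProc_trunc_sub hu hv, Real.coe_toNNReal _ (by positivity)]
    unfold empProc
    rw [abs_mul, abs_of_nonneg (by positivity : 0 ≤ (√(n : ℝ))⁻¹), mul_assoc]
    refine mul_le_mul_of_nonneg_left ?_ (by positivity)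
    refine (Finset.abs_sum_le_sum_abs _ _).trans ?_
    calc _ ≤ ∑ _i : Fin n, 2 * √n * ‖u - v‖ := by
          refine Finset.sum_le_sum fun i _ => ?_
          refine (abs_sub _ _).trans ?_
          linarith [hz i u v hu hv, hint u v hu hv]
      _ = _ := by simp [mul_assoc]
  exact hlip.continuousOn.continuousAt (Metric.isOpen_ball.mem_nhds (by simpa using hu))

/-- The truncated empirical process is controlled by chaining, with exponentially high
probability. -/
lemma measure_not_chainBound_le [IsProbabilityMeasure P]
    (hg : IsLipFamily P g M R) (hR : √p + 1 < R) {n : ℕ}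
    (hn : 0 < n) {t : ℝ} (ht : 0 ≤ t) :
    (Measure.pi fun _ : Fin n => P) {z | ¬ (ChainBound p t
      (fun u => empProc P (trunc M n (g u)) z) ∧ ∀ u, ‖u‖ < R →
      ContinuousAt (fun u => empProc P (trunc M n (g u)) z) u)} ≤
      ENNReal.ofReal (2 * Real.exp ((∫ z, M z ^ 2 ∂P) / 4) * Real.exp (-t / 2)) := by
  have h := SplitAverage.measure_not_chainBound_le (p := p) (μ := Measure.pi fun _ : Fin n => P)
    (X := fun u z => empProc P (trunc M n (g u)) z)
    (C := 2 * Real.exp ((∫ z, M z ^ 2 ∂P) / 4)) (by positivity)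
    (fun a b ha hb hab t _ => hg.measure_lt_abs_sub_le hn (by linarith) (by linarith) hab t) ht
  refine le_trans (measure_mono_ae ?_) h
  filter_upwards [hg.ae_continuousAt n] with z hz
  intro hz2 hz3
  exact hz2 ⟨hz3, hz⟩

/-- If no observation is truncated, then truncation changes only the centring of the empirical
process, and this little. -/
lemma abs_empProc_sub_trunc_le [IsProbabilityMeasure P]
    (hg : IsLipFamily P g M R) {n : ℕ} (hn : 0 < n)
    {z : Fin n → 𝒵} (hz : ∀ i, M (z i) ≤ √n) {u : Param p} (hu : ‖u‖ < R) :
    |empProc P (g u) z - empProc P (trunc M n (g u)) z| ≤ tailSq P M n * ‖u‖ := by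
  have hn' : (0 : ℝ) < n := by exact_mod_cast hn
  have hsn : 0 < √(n : ℝ) := Real.sqrt_pos.2 hn'
  have h1 : empProc P (g u) z - empProc P (trunc M n (g u)) z =
      -∫ y, √n * (g u y - trunc M n (g u) y) ∂P := by
    unfold empProc
    rw [integral_const_mul, integral_sub ((hg.memLp_apply hu).integrable one_le_two)
      ((hg.memLp_trunc n hu).integrable one_le_two), ← mul_sub, ← Finset.sum_sub_distrib]
    have : ∀ i ∈ Finset.univ, g u (z i) - ∫ y, g u y ∂P - (trunc M n (g u) (z i) -
        ∫ y, trunc M n (g u) y ∂P) = -(∫ y, g u y ∂P - ∫ y, trunc M n (g u) y ∂P) := by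
      intro i _
      rw [trunc_of_le (hz i)]
      ring
    rw [Finset.sum_congr rfl this, Finset.sum_const, Finset.card_univ, Fintype.card_fin,
      nsmul_eq_mul, ← mul_assoc]
    have h2 : (√(n : ℝ))⁻¹ * n = √n := by
      rw [inv_mul_eq_div, Real.div_sqrt]
    rw [h2]
    ring
  rw [h1, abs_neg]
  unfold tailSq
  rw [← integral_mul_const]
  rw [← Real.norm_eq_abs]
  refine norm_integral_le_of_norm_le ?_ ?_
  · refine Integrable.mul_const ?_ _
    exact hg.memLp.integrable_sq.indicator (measurableSet_lt measurable_const hg.measurable)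
  · filter_upwards [hg.abs_le ((norm_nonneg u).trans_lt hu)] with y hy
    rcases le_or_gt (M y) (√n) with h | h
    · rw [trunc_of_le h, sub_self, mul_zero, norm_zero]
      exact mul_nonneg (Set.indicator_nonneg (fun z _ => sq_nonneg _) y) (norm_nonneg _)
    · rw [trunc_of_lt h, sub_zero, Set.indicator_of_mem (s := {z | √n < M z}) h, norm_mul,
        Real.norm_of_nonneg hsn.le, Real.norm_eq_abs]
      calc √n * |g u y| ≤ M y * (M y * ‖u‖) :=
            mul_le_mul h.le (hy u hu) (abs_nonneg _) (hg.nonneg y)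
        _ = _ := by ring

/-- The constant of the maximal inequality, for a Lipschitz coefficient with second moment `s`. -/
noncomputable def maxConst (p : ℕ) (s : ℝ) : ℝ := √p * (5 + 9 * chainSlope p) + s

lemma empProc_trunc_zero (hg : IsLipFamily P g M R) {n : ℕ} (z : Fin n → 𝒵) :
    empProc P (trunc M n (g 0)) z = 0 := by
  have : g 0 = fun _ => 0 := funext hg.zero
  simp [empProc, this, trunc]

/-- Maximal inequality: the empirical process over a Lipschitz family indexed by the unit ball has
a supremum with exponential tails, uniformly in the family and in `n`. -/
lemma measure_exists_lt_abs_empProc_le [IsProbabilityMeasure P]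
    (hg : IsLipFamily P g M R) (hR : √p + 1 < R) {n : ℕ}
    (hn : 0 < n) {t : ℝ} (ht : 0 ≤ t) :
    (Measure.pi fun _ : Fin n => P) {z | (∀ i, M (z i) ≤ √n) ∧
      ∃ u, ‖u‖ ≤ 1 ∧ maxConst p (∫ z, M z ^ 2 ∂P) * (t + 1) < |empProc P (g u) z|} ≤
      ENNReal.ofReal (2 * Real.exp ((∫ z, M z ^ 2 ∂P) / 4) * Real.exp (-t / 2)) := by
  refine le_trans (measure_mono ?_) (hg.measure_not_chainBound_le hR hn ht)
  rintro z ⟨hz, u, hu, hlt⟩ ⟨hcb, hc⟩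
  have hs0 : 0 ≤ √(p : ℝ) := Real.sqrt_nonneg _
  have huR : ‖u‖ < R := by linarith
  have h1 := hcb.abs_sub_zero_le ht hu (hc u huR)
  simp only [hg.empProc_trunc_zero, sub_zero] at h1
  have h2 := hg.abs_empProc_sub_trunc_le hn hz huR
  have h3 : tailSq P M n * ‖u‖ ≤ (∫ z, M z ^ 2 ∂P) * 1 := by
    refine mul_le_mul (tailSq_le hg.memLp n) hu (norm_nonneg _) ?_
    exact integral_nonneg fun z => sq_nonneg _
  have h4 : 0 ≤ ∫ z, M z ^ 2 ∂P := integral_nonneg fun z => sq_nonneg _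
  have h5 := abs_add_le (empProc P (g u) z - empProc P (trunc M n (g u)) z)
    (empProc P (trunc M n (g u)) z)
  rw [sub_add_cancel] at h5
  have h6 := mul_nonneg h4 ht
  unfold maxConst at hlt
  nlinarith

end IsLipFamily

/-- Stochastic equicontinuity: if the members of a sequence of Lipschitz families with a common
Lipschitz coefficient tend to zero in `L²`, then the empirical process tends to zero in probability
uniformly over the unit ball. -/
lemma tendsto_measure_exists_lt_abs_empProc [IsProbabilityMeasure P]
    {g : ℕ → Param p → 𝒵 → ℝ} {R : ℕ → ℝ}
    (hg : ∀ᶠ n in atTop, IsLipFamily P (g n) M (R n)) (hR : ∀ᶠ n in atTop, √p + 1 < R n)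
    (hMm : Measurable M) (hM : MemLp M 2 P)
    (hlim : ∀ u, Tendsto (fun n => ∫ z, g n u z ^ 2 ∂P) atTop (𝓝 0)) {ε : ℝ} (hε : 0 < ε) :
    Tendsto (fun n : ℕ => (Measure.pi fun _ : Fin n => P)
      {z | ∃ u, ‖u‖ ≤ 1 ∧ ε < |empProc P (g n u) z|}) atTop (𝓝 0) := by
  set s := ∫ z, M z ^ 2 ∂P
  rw [ENNReal.tendsto_nhds_zero]
  intro δ hδ
  -- the level `t` makes the chaining event likely
  obtain ⟨t, ht0, ht⟩ : ∃ t : ℝ, 0 ≤ t ∧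
      ENNReal.ofReal (2 * Real.exp (s / 4) * Real.exp (-t / 2)) ≤ δ / 2 := by
    have h1 : Tendsto (fun t : ℝ => ENNReal.ofReal (2 * Real.exp (s / 4) * Real.exp (-t / 2)))
        atTop (𝓝 0) := by
      have h2 : Tendsto (fun t : ℝ => Real.exp (-t / 2)) atTop (𝓝 0) := by
        refine Real.tendsto_exp_atBot.comp ?_
        have := (tendsto_neg_atTop_atBot (G := ℝ)).atBot_div_const (r := 2) two_pos
        exact this
      have h3 := ENNReal.tendsto_ofReal (h2.const_mul (2 * Real.exp (s / 4)))
      simpa using h3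
    have h4 := (ENNReal.tendsto_nhds_zero.1 h1 (δ / 2) (ENNReal.half_pos hδ.ne')).and
      (eventually_ge_atTop 0)
    obtain ⟨t, h5, h6⟩ := h4.exists
    exact ⟨t, h6, h5⟩
  -- the grid level `k` makes the rounding error small
  obtain ⟨k, hk⟩ : ∃ k : ℕ, 4 * √p * (t + chainSlope p * (k + 2)) / 2 ^ k ≤ ε / 3 := by
    have h1 : Tendsto (fun k : ℕ => 4 * √p * (t + 2 * chainSlope p) * (1 / 2 : ℝ) ^ k +
        4 * √p * chainSlope p * (k * (1 / 2 : ℝ) ^ k)) atTop (𝓝 0) := by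
      have h2 := tendsto_pow_atTop_nhds_zero_of_lt_one (r := (1 / 2 : ℝ)) (by norm_num)
        (by norm_num)
      have h3 := tendsto_self_mul_const_pow_of_lt_one (r := (1 / 2 : ℝ)) (by norm_num)
        (by norm_num)
      simpa using (h2.const_mul (4 * √p * (t + 2 * chainSlope p))).add
        (h3.const_mul (4 * √p * chainSlope p))
    obtain ⟨k, hk⟩ := (h1.eventually_le_const (by positivity : 0 < ε / 3)).exists
    refine ⟨k, le_trans (le_of_eq ?_) hk⟩
    rw [one_div, inv_pow]
    ring
  -- at the finitely many grid points Chebyshev's inequality applies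
  have hgrid : Tendsto (fun n : ℕ => ∑ a ∈ grid p k,
      ENNReal.ofReal ((∫ z, g n a z ^ 2 ∂P) / (ε / 3) ^ 2)) atTop (𝓝 0) := by
    rw [← Finset.sum_const_zero (s := grid p k)]
    refine tendsto_finsetSum _ fun a _ => ?_
    have := ENNReal.tendsto_ofReal ((hlim a).div_const ((ε / 3) ^ 2))
    simpa using this
  have htail := tendsto_tailSq hMm hM
  have htail' : Tendsto (fun n => ENNReal.ofReal (tailSq P M n)) atTop (𝓝 0) := by
    simpa using ENNReal.tendsto_ofReal htail
  have hsum := ENNReal.tendsto_nhds_zero.1 (by simpa using hgrid.add htail') (δ / 2)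
    (ENNReal.half_pos hδ.ne')
  filter_upwards [hg, hR, hsum, htail.eventually_le_const (by positivity : 0 < ε / 3),
    eventually_gt_atTop 0] with n hgn hRn hsn htn hn
  have hs0 : 0 ≤ √(p : ℝ) := Real.sqrt_nonneg _
  have hsub : {z : Fin n → 𝒵 | ∃ u, ‖u‖ ≤ 1 ∧ ε < |empProc P (g n u) z|} ⊆
      {z | ¬ (ChainBound p t (fun u => empProc P (trunc M n (g n u)) z) ∧ ∀ u, ‖u‖ < R n →
        ContinuousAt (fun u => empProc P (trunc M n (g n u)) z) u)} ∪
      ((⋃ a ∈ grid p k, {z | ε / 3 ≤ |empProc P (trunc M n (g n a)) z|}) ∪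
        {z | ¬ ∀ i, M (z i) ≤ √n}) := by
    rintro z ⟨u, hu, hlt⟩
    by_contra hcon
    rw [Set.mem_union, Set.mem_union, not_or, not_or] at hcon
    obtain ⟨hc1, hc2, hc3⟩ := hcon
    obtain ⟨hcb, hc⟩ := not_not.1 hc1
    have hz : ∀ i, M (z i) ≤ √n := not_not.1 hc3
    have huR : ‖u‖ < R n := by linarith
    have h1 := hcb.abs_sub_gridRound_le ht0 hu (hc u huR) k
    have h2 : |empProc P (trunc M n (g n (gridRound k u))) z| < ε / 3 := by
      by_contra h
      exact hc2 (Set.mem_biUnion (gridRound_mem k hu) (not_lt.1 h))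
    have h3 := hgn.abs_empProc_sub_trunc_le hn hz huR
    have h4 : tailSq P M n * ‖u‖ ≤ ε / 3 :=
      (mul_le_mul htn hu (norm_nonneg _) (by positivity)).trans_eq (mul_one _)
    have h5 := abs_add_le (empProc P (g n u) z - empProc P (trunc M n (g n u)) z)
      (empProc P (trunc M n (g n u)) z)
    have h6 := abs_add_le (empProc P (trunc M n (g n u)) z -
      empProc P (trunc M n (g n (gridRound k u))) z) (empProc P (trunc M n (g n (gridRound k u))) z)
    rw [sub_add_cancel] at h5 h6
    linarith
  calc _ ≤ _ := measure_mono hsub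
    _ ≤ _ := (measure_union_le _ _).trans (add_le_add_right (measure_union_le _ _) _)
    _ ≤ δ / 2 + δ / 2 := by
      refine add_le_add ((hgn.measure_not_chainBound_le hRn hn ht0).trans ht) (le_trans ?_ hsn)
      refine add_le_add ?_ (measure_exists_lt_le hMm hM n)
      refine (measure_biUnion_finset_le _ _).trans (Finset.sum_le_sum fun a ha => ?_)
      have haR : ‖a‖ < R n := by linarith [norm_le_of_mem_grid ha]
      refine (measure_le_abs_empProc_le (hgn.memLp_trunc n haR) (by positivity)).trans ?_
      refine ENNReal.ofReal_le_ofReal ?_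
      gcongr ?_ / _
      refine integral_mono_of_nonneg (ae_of_all _ fun z => sq_nonneg _)
        (hgn.memLp_apply haR).integrable_sq (ae_of_all _ fun z => ?_)
      rcases le_or_gt (M z) (√n) with h | h
      · simp only [trunc_of_le h]; exact le_rfl
      · simp only [trunc_of_lt h, ne_eq, OfNat.ofNat_ne_zero, not_false_eq_true, zero_pow]
        exact sq_nonneg _
    _ = δ := ENNReal.add_halves δ

end Lip

/-! ### The local model at the minimizer -/

/-- The excess loss `f(z, θs + h) - f(z, θs)` as a function of the local parameter `h`. -/
def excess {p : ℕ} {𝒵 : Type*} (f : 𝒵 → Param p → ℝ) (θs h : Param p) (z : 𝒵) : ℝ :=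
  f z (θs + h) - f z θs

/-- The remainder of the linearization of `F` at `0`, where `ψ` is the gradient. -/
noncomputable def linRem {p : ℕ} {𝒵 : Type*} (F : Param p → 𝒵 → ℝ) (ψ : 𝒵 → Param p) (h : Param p)
    (z : 𝒵) : ℝ :=
  F h z - inner ℝ (ψ z) h

/-- The local structure of the learning problem at its minimizer: a Lipschitz family `F` which is
differentiable in quadratic mean at `0` with centred gradient `ψ`, and whose mean has a second
order Taylor expansion at `0` with positive definite Hessian `V` and without linear term. -/
structure IsLocalModel {p : ℕ} {𝒵 : Type*} [MeasurableSpace 𝒵] (P : Measure 𝒵)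
    (F : Param p → 𝒵 → ℝ) (M : 𝒵 → ℝ) (r : ℝ) (ψ : 𝒵 → Param p)
    (V : Param p →L[ℝ] Param p) : Prop where
  pos : 0 < r
  lip : IsLipFamily P F M r
  taylor : (fun h : Param p => ∫ z, F h z ∂P - (1 / 2) * inner ℝ h (V h)) =o[𝓝 0]
    fun h => ‖h‖ ^ 2
  symm : ∀ u v : Param p, inner ℝ (V u) v = inner ℝ u (V v)
  isUnit : IsUnit V
  coercive : ∃ c : ℝ, 0 < c ∧ ∀ h : Param p, c * ‖h‖ ^ 2 ≤ inner ℝ h (V h)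
  memLp_grad : MemLp ψ 2 P
  integral_grad : ∫ z, ψ z ∂P = 0
  quadraticMean : Tendsto (fun h : Param p => (∫ z, linRem F ψ h z ^ 2 ∂P) / ‖h‖ ^ 2)
    (𝓝[≠] 0) (𝓝 0)

section Deterministic

variable {p : ℕ}

/-- Fermat's rule in the form of a first order expansion. -/
lemma eq_zero_of_isLittleO {ρ : Param p → ℝ} {b : Param p} (h0 : ρ 0 = 0)
    (hpos : ∀ᶠ h in 𝓝 0, 0 ≤ ρ h)
    (hb : (fun h => ρ h - inner ℝ b h) =o[𝓝 0] fun h : Param p => h) : b = 0 := by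
  have hd : HasFDerivAt ρ (innerSL ℝ b) 0 := by
    rw [hasFDerivAt_iff_isLittleO_nhds_zero]
    simpa [h0] using hb
  have hm : IsLocalMin ρ 0 := by
    filter_upwards [hpos] with h hh
    rwa [h0]
  have := DFunLike.congr_fun (hm.hasFDerivAt_eq_zero hd) b
  simpa using this

/-- A quadratic form that is the leading term of a nonnegative function is positive
semidefinite. -/
lemma inner_nonneg_of_isLittleO {ρ : Param p → ℝ} {V : Param p →L[ℝ] Param p}
    (hpos : ∀ᶠ h in 𝓝 0, 0 ≤ ρ h)
    (hV : (fun h : Param p => ρ h - (1 / 2) * inner ℝ h (V h)) =o[𝓝 0] fun h => ‖h‖ ^ 2)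
    (h : Param p) : 0 ≤ inner ℝ h (V h) := by
  by_contra! hneg
  have hh : h ≠ 0 := by rintro rfl; simp at hneg
  have hh' : 0 < ‖h‖ ^ 2 := by positivity
  set q : ℝ := inner ℝ h (V h)
  have hev := (Asymptotics.isLittleO_iff.1 hV
    (by apply div_pos (neg_pos.2 hneg); positivity : 0 < -q / (4 * ‖h‖ ^ 2))).and hpos
  have hlim : Tendsto (fun t : ℝ => t • h) (𝓝[>] 0) (𝓝 0) := by
    have : Tendsto (fun t : ℝ => t • h) (𝓝 0) (𝓝 ((0 : ℝ) • h)) :=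
      tendsto_id.smul_const h
    rw [zero_smul] at this
    exact this.mono_left nhdsWithin_le_nhds
  obtain ⟨t, ⟨h1, h2⟩, h3⟩ := ((hlim.eventually hev).and self_mem_nhdsWithin).exists
  have h3' : 0 < t := h3
  have h4 : inner ℝ (t • h) (V (t • h)) = t ^ 2 * q := by
    rw [map_smul, inner_smul_left, inner_smul_right]
    simp [q]; ring
  rw [h4, Real.norm_eq_abs, norm_pow, norm_norm, norm_smul, mul_pow, Real.norm_eq_abs, sq_abs] at h1
  have h5 : -q / (4 * ‖h‖ ^ 2) * (t ^ 2 * ‖h‖ ^ 2) = -q / 4 * t ^ 2 := by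
    field_simp
  rw [h5] at h1
  have := (abs_le.1 h1).2
  nlinarith [mul_pos (pow_pos h3' 2) (neg_pos.2 hneg)]

/-- A symmetric, invertible and positive semidefinite operator is positive definite. -/
lemma exists_coercive {V : Param p →L[ℝ] Param p} (hs : ∀ u v, inner ℝ (V u) v = inner ℝ u (V v))
    (hu : IsUnit V) (hV : ∀ h, 0 ≤ inner ℝ h (V h)) :
    ∃ c : ℝ, 0 < c ∧ ∀ h, c * ‖h‖ ^ 2 ≤ inner ℝ h (V h) := by
  obtain ⟨W, hW⟩ := hu.exists_left_inv
  have hWV : ∀ h, W (V h) = h := fun h => by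
    simpa using DFunLike.congr_fun hW h
  set a := ‖V‖ + 1
  set b := ‖W‖ + 1
  have ha : 0 < a := by positivity
  have hb : 0 < b := by positivity
  refine ⟨1 / (a * b ^ 2), by positivity, fun h => ?_⟩
  -- the form at `h - a⁻¹ • V h` is nonnegative, which bounds `‖V h‖²`
  have h1 : ‖V h‖ ^ 2 ≤ a * inner ℝ h (V h) := by
    have h2 := hV (h - a⁻¹ • V h)
    have h3 : inner ℝ (h - a⁻¹ • V h) (V (h - a⁻¹ • V h)) =
        inner ℝ h (V h) - 2 * a⁻¹ * ‖V h‖ ^ 2 + a⁻¹ ^ 2 * inner ℝ (V h) (V (V h)) := by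
      rw [map_sub, map_smul, inner_sub_left, inner_sub_right, inner_sub_right, inner_smul_left,
        inner_smul_right, inner_smul_left, inner_smul_right, ← hs h (V h),
        real_inner_self_eq_norm_sq]
      simp only [conj_trivial]
      ring
    have h4 : inner ℝ (V h) (V (V h)) ≤ a * ‖V h‖ ^ 2 := by
      calc _ ≤ ‖V h‖ * ‖V (V h)‖ := real_inner_le_norm _ _
        _ ≤ ‖V h‖ * (‖V‖ * ‖V h‖) := by gcongr; exact V.le_opNorm _
        _ ≤ ‖V h‖ * (a * ‖V h‖) := by gcongr; simp [a]
        _ = _ := by ring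
    have h5 : a⁻¹ ^ 2 * inner ℝ (V h) (V (V h)) ≤ a⁻¹ ^ 2 * (a * ‖V h‖ ^ 2) := by gcongr
    have h6 : a⁻¹ ^ 2 * (a * ‖V h‖ ^ 2) = a⁻¹ * ‖V h‖ ^ 2 := by field_simp
    have h7 : a⁻¹ * ‖V h‖ ^ 2 ≤ inner ℝ h (V h) := by
      rw [h3] at h2
      linarith
    rwa [inv_mul_le_iff₀ ha] at h7
  have h2 : ‖h‖ ^ 2 ≤ b ^ 2 * ‖V h‖ ^ 2 := by
    rw [← mul_pow]
    refine pow_le_pow_left₀ (norm_nonneg _) ?_ 2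
    calc ‖h‖ = ‖W (V h)‖ := by rw [hWV]
      _ ≤ ‖W‖ * ‖V h‖ := W.le_opNorm _
      _ ≤ _ := by gcongr; simp [b]
  rw [one_div, inv_mul_le_iff₀ (by positivity)]
  calc ‖h‖ ^ 2 ≤ b ^ 2 * ‖V h‖ ^ 2 := h2
    _ ≤ b ^ 2 * (a * inner ℝ h (V h)) := by gcongr
    _ = _ := by ring

end Deterministic

section Gradient

variable {p : ℕ} {𝒵 : Type*} [MeasurableSpace 𝒵] {P : Measure 𝒵} {F : Param p → 𝒵 → ℝ}
  {M : 𝒵 → ℝ} {r : ℝ} {ψ : 𝒵 → Param p}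

/-- Differentiability at `0` along subsequences: every sequence of increments has a subsequence
along which the linearization remainder is almost surely of smaller order. This is what almost sure
differentiability and differentiability in probability have in common. -/
def HasSubseqGradient (P : Measure 𝒵) (F : Param p → 𝒵 → ℝ) (ψ : 𝒵 → Param p) : Prop :=
  ∀ x : ℕ → Param p, Tendsto x atTop (𝓝[≠] 0) → ∃ ns : ℕ → ℕ, StrictMono ns ∧
    ∀ᵐ z ∂P, Tendsto (fun k => linRem F ψ (x (ns k)) z / ‖x (ns k)‖) atTop (𝓝 0)

lemma HasGradientAS.hasSubseqGradient {f : 𝒵 → Param p → ℝ} {θs : Param p}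
    (h : HasGradientAS P f θs ψ) : HasSubseqGradient P (excess f θs) ψ := by
  intro x hx
  refine ⟨id, strictMono_id, ?_⟩
  filter_upwards [h] with z hz
  have h1 := hasFDerivAt_iff_isLittleO_nhds_zero.1 hz.hasFDerivAt
  have h2 := (h1.comp_tendsto (tendsto_nhds_of_tendsto_nhdsWithin hx)).norm_right
  simpa [Function.comp_def, linRem, excess] using h2.tendsto_div_nhds_zero

lemma HasGradientInProb.hasSubseqGradient {f : 𝒵 → Param p → ℝ} {θs : Param p}
    (h : HasGradientInProb P f θs ψ) : HasSubseqGradient P (excess f θs) ψ := by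
  intro x hx
  obtain ⟨ns, h1, h2⟩ := (h.2.comp hx).exists_seq_tendsto_ae
  exact ⟨ns, h1, h2⟩

/-- The coordinates of the gradient are measurable and bounded by the Lipschitz coefficient, being
limits of difference quotients. -/
lemma HasSubseqGradient.apply (h : HasSubseqGradient P F ψ) (hF : IsLipFamily P F M r)
    (hr : 0 < r) (i : Fin p) :
    AEMeasurable (fun z => ψ z i) P ∧ ∀ᵐ z ∂P, |ψ z i| ≤ M z := by
  let e : Param p := EuclideanSpace.single i 1
  have he : ‖e‖ = 1 := by simp [e]
  let x : ℕ → Param p := fun k => (r / (k + 2)) • e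
  have hxn : ∀ k, ‖x k‖ = r / (k + 2) := fun k => by
    simp only [x]
    rw [norm_smul, he, mul_one, Real.norm_of_nonneg (by positivity)]
  have hxr : ∀ k, ‖x k‖ < r := fun k => by
    rw [hxn]
    refine div_lt_self hr ?_
    have : (0 : ℝ) ≤ k := Nat.cast_nonneg k
    linarith
  have hx0 : ∀ k, 0 < ‖x k‖ := fun k => by rw [hxn]; positivity
  have hx : Tendsto x atTop (𝓝[≠] 0) := by
    refine tendsto_nhdsWithin_iff.2 ⟨?_, Eventually.of_forall fun k => norm_pos_iff.1 (hx0 k)⟩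
    rw [tendsto_zero_iff_norm_tendsto_zero]
    simp only [hxn]
    exact Tendsto.div_atTop tendsto_const_nhds
      (tendsto_atTop_add_const_right _ _ tendsto_natCast_atTop_atTop)
  obtain ⟨ns, -, hns⟩ := h x hx
  have hin : ∀ k z, inner ℝ (ψ z) (x k) / ‖x k‖ = ψ z i := by
    intro k z
    rw [hxn]
    simp only [x, e]
    rw [inner_smul_right]
    have : r / ((k : ℝ) + 2) ≠ 0 := by positivity
    rw [mul_div_cancel_left₀ _ this]
    simp [EuclideanSpace.inner_single_right]
  have hlim : ∀ᵐ z ∂P, Tendsto (fun k => F (x (ns k)) z / ‖x (ns k)‖) atTop (𝓝 (ψ z i)) := by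
    filter_upwards [hns] with z hz
    have := hz.add_const (ψ z i)
    rw [zero_add] at this
    refine this.congr fun k => ?_
    rw [linRem, sub_div, hin, sub_add_cancel]
  constructor
  · exact aemeasurable_of_tendsto_metrizable_ae atTop
      (fun k => (hF.aemeasurable _ (hxr _)).div_const _) hlim
  · filter_upwards [hlim, hF.abs_le hr] with z hz hM
    refine le_of_tendsto' hz.abs fun k => ?_
    rw [abs_div, abs_norm, div_le_iff₀ (hx0 _)]
    exact hM _ (hxr _)

lemma HasSubseqGradient.ae_norm_le (h : HasSubseqGradient P F ψ) (hF : IsLipFamily P F M r)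
    (hr : 0 < r) : ∀ᵐ z ∂P, ‖ψ z‖ ≤ √p * M z := by
  filter_upwards [ae_all_iff.2 fun i => (h.apply hF hr i).2] with z hz
  exact norm_le_sqrt_mul (hF.nonneg z) hz

lemma HasSubseqGradient.memLp (h : HasSubseqGradient P F ψ) (hF : IsLipFamily P F M r)
    (hr : 0 < r) : MemLp ψ 2 P := by
  have hm : AEMeasurable ψ P := by
    have h1 : AEMeasurable (fun z i => ψ z i) P :=
      aemeasurable_pi_lambda _ fun i => (h.apply hF hr i).1
    exact (WithLp.measurable_toLp 2 (Fin p → ℝ)).comp_aemeasurable h1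
  refine (hF.memLp.const_mul √p).mono hm.aestronglyMeasurable ?_
  filter_upwards [h.ae_norm_le hF hr] with z hz
  exact hz.trans (le_abs_self _)

lemma memLp_linRem [IsFiniteMeasure P] (hF : IsLipFamily P F M r) (hψ : MemLp ψ 2 P) {h : Param p}
    (hh : ‖h‖ < r) : MemLp (linRem F ψ h) 2 P :=
  (hF.memLp_apply hh).sub (hψ.inner_const h)

/-- Differentiability in quadratic mean, by dominated convergence along subsequences. -/
lemma HasSubseqGradient.tendsto_quadraticMean [IsFiniteMeasure P] (h : HasSubseqGradient P F ψ)
    (hF : IsLipFamily P F M r) (hr : 0 < r) :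
    Tendsto (fun h : Param p => (∫ z, linRem F ψ h z ^ 2 ∂P) / ‖h‖ ^ 2) (𝓝[≠] 0) (𝓝 0) := by
  have hψ := h.memLp hF hr
  refine tendsto_of_subseq_tendsto fun x hx => ?_
  obtain ⟨ns, hns, hlim⟩ := h x hx
  refine ⟨ns, ?_⟩
  have hxns : Tendsto (fun k => x (ns k)) atTop (𝓝[≠] 0) := hx.comp hns.tendsto_atTop
  have hx0 : ∀ᶠ k in atTop, x (ns k) ≠ 0 := hxns.eventually self_mem_nhdsWithin
  have hxr : ∀ᶠ k in atTop, ‖x (ns k)‖ < r := by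
    have := (tendsto_nhds_of_tendsto_nhdsWithin hxns).norm
    rw [norm_zero] at this
    exact this.eventually_lt_const hr
  have h1 : Tendsto (fun k => ∫ z, (linRem F ψ (x (ns k)) z / ‖x (ns k)‖) ^ 2 ∂P) atTop
      (𝓝 (∫ _z, (0 : ℝ) ∂P)) := by
    refine tendsto_integral_filter_of_dominated_convergence
      (fun z => ((1 + √p) * M z) ^ 2) ?_ ?_ (hF.memLp.const_mul _).integrable_sq ?_
    · filter_upwards [hxr] with k hk
      exact ((memLp_linRem hF hψ hk).1.aemeasurable.div_const _).pow_const 2 |>.aestronglyMeasurable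
    · filter_upwards [hx0, hxr] with k hk0 hkr
      filter_upwards [hF.abs_le hr, h.ae_norm_le hF hr] with z hz hz2
      have hpos : 0 < ‖x (ns k)‖ := norm_pos_iff.2 hk0
      rw [Real.norm_of_nonneg (sq_nonneg _), ← sq_abs]
      refine pow_le_pow_left₀ (abs_nonneg _) ?_ 2
      rw [abs_div, abs_norm, div_le_iff₀ hpos, linRem]
      calc _ ≤ |F (x (ns k)) z| + |inner ℝ (ψ z) (x (ns k))| := abs_sub _ _
        _ ≤ M z * ‖x (ns k)‖ + √p * M z * ‖x (ns k)‖ := by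
          refine add_le_add (hz _ hkr) ((abs_real_inner_le_norm _ _).trans ?_)
          gcongr
        _ = _ := by ring
    · filter_upwards [hlim] with z hz
      simpa using hz.pow 2
  rw [integral_zero] at h1
  refine h1.congr fun k => ?_
  simp only [div_pow]
  rw [integral_div]

lemma sq_integral_le [IsProbabilityMeasure P] {X : 𝒵 → ℝ} (hX : MemLp X 2 P) :
    (∫ z, X z ∂P) ^ 2 ≤ ∫ z, X z ^ 2 ∂P := by
  have h := variance_nonneg X P
  rw [variance_eq_sub hX] at h
  simpa using h

lemma integral_inner_grad [IsFiniteMeasure P] (hψ : MemLp ψ 2 P) (h : Param p) :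
    ∫ z, inner ℝ (ψ z) h ∂P = inner ℝ (∫ z, ψ z ∂P) h := by
  have := integral_inner (𝕜 := ℝ) (hψ.integrable one_le_two) h
  simp_rw [real_inner_comm _ h] at this
  rw [← this]

/-- The gradient has mean zero, because the mean of `F` is minimal at `0`. -/
lemma integral_grad_eq_zero [IsProbabilityMeasure P] (hF : IsLipFamily P F M r) (hr : 0 < r)
    (hψ : MemLp ψ 2 P) (hpos : ∀ᶠ h in 𝓝 0, 0 ≤ ∫ z, F h z ∂P)
    (hq : Tendsto (fun h : Param p => (∫ z, linRem F ψ h z ^ 2 ∂P) / ‖h‖ ^ 2) (𝓝[≠] 0) (𝓝 0)) :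
    ∫ z, ψ z ∂P = 0 := by
  refine eq_zero_of_isLittleO (ρ := fun h => ∫ z, F h z ∂P) (by simp [hF.zero]) hpos ?_
  rw [Asymptotics.isLittleO_iff]
  intro c hc
  have h1 := hq.eventually_le_const (by positivity : 0 < c ^ 2)
  rw [eventually_nhdsWithin_iff] at h1
  have h2 : ∀ᶠ h : Param p in 𝓝 0, ‖h‖ < r := by
    filter_upwards [Metric.ball_mem_nhds (0 : Param p) hr] with h hh
    simpa using hh
  filter_upwards [h1, h2] with h hh hhr
  by_cases h0 : h = 0
  · simp [h0, hF.zero]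
  have hh' := hh h0
  rw [div_le_iff₀ (by positivity), ← mul_pow] at hh'
  have h3 : ∫ z, linRem F ψ h z ∂P = ∫ z, F h z ∂P - inner ℝ (∫ z, ψ z ∂P) h := by
    unfold linRem
    rw [integral_sub ((hF.memLp_apply hhr).integrable one_le_two)
      ((hψ.inner_const h).integrable one_le_two), integral_inner_grad hψ]
  rw [← h3, Real.norm_eq_abs]
  exact abs_le_of_sq_le_sq ((sq_integral_le (memLp_linRem hF hψ hhr)).trans hh') (by positivity)

end Gradient

section Problem

variable {p : ℕ} {𝒵 : Type*} [MeasurableSpace 𝒵] {P : Measure 𝒵} [IsProbabilityMeasure P]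
  {Θ : Set (Param p)} {f : 𝒵 → Param p → ℝ} {θs : Param p}

omit [IsProbabilityMeasure P] in
/-- The excess loss is a Lipschitz family. The absolute value of a measurable version of the given
Lipschitz coefficient serves as Lipschitz coefficient. -/
lemma IsLipschitzNear.exists_isLipFamily (hf : IsLearningProblem P Θ f θs)
    (hL : IsLipschitzNear P Θ f θs) :
    ∃ (r : ℝ) (M : 𝒵 → ℝ), 0 < r ∧ Metric.ball θs r ⊆ Θ ∧ IsLipFamily P (excess f θs) M r := by
  obtain ⟨r₁, hr₁, M, hM, hlip⟩ := hL
  obtain ⟨r₂, hr₂, hball⟩ := Metric.isOpen_iff.1 hf.isOpen θs hf.mem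
  have hmem : ∀ {u : Param p}, ‖u‖ < min r₁ r₂ → θs + u ∈ Metric.ball θs r₁ ∩ Θ := by
    intro u hu
    refine ⟨?_, hball ?_⟩
    · simpa using hu.trans_le (min_le_left _ _)
    · simpa using hu.trans_le (min_le_right _ _)
  refine ⟨min r₁ r₂, fun z => |hM.1.mk M z|, lt_min hr₁ hr₂,
    (Metric.ball_subset_ball (min_le_right _ _)).trans hball, ?_⟩
  refine ⟨fun u hu => ?_, fun z => ?_, ?_, fun z => abs_nonneg _, ?_, ?_⟩
  · exact ((hf.measurable _ (hmem hu).2).sub (hf.measurable _ hf.mem)).aemeasurable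
  · simp [excess]
  · exact (hM.1.stronglyMeasurable_mk.measurable).abs
  · exact (hM.ae_eq hM.1.ae_eq_mk).abs
  · filter_upwards [hlip, hM.1.ae_eq_mk] with z hz hzM u v hu hv
    have h1 := hz _ (hmem hu) _ (hmem hv)
    have h2 : excess f θs u z - excess f θs v z = f z (θs + u) - f z (θs + v) := by
      simp only [excess]; ring
    rw [h2]
    refine h1.trans ?_
    rw [add_sub_add_left_eq_sub, hzM]
    gcongr
    exact le_abs_self _

/-- The loss is integrable near the minimizer: the minimal risk is finite, since it is strictly
smaller than another risk. -/
lemma IsLearningProblem.integrable_loss (hf : IsLearningProblem P Θ f θs) [Nontrivial (Param p)]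
    {M : 𝒵 → ℝ} {r : ℝ} (hr : 0 < r) (hball : Metric.ball θs r ⊆ Θ)
    (hF : IsLipFamily P (excess f θs) M r) {h : Param p} (hh : ‖h‖ < r) :
    Integrable (fun z => f z (θs + h)) P := by
  have hfin : risk P f θs < ⊤ := by
    obtain ⟨u, hu⟩ := exists_norm_eq (Param p) (by positivity : 0 ≤ r / 2)
    have hu0 : u ≠ 0 := by rintro rfl; simp at hu; linarith
    have h1 : θs + u ∈ Θ := hball (by simp [hu, hr])
    exact (hf.unique_min _ h1 (by simpa using hu0)).trans_le le_top
  have hi0 : Integrable (fun z => f z θs) P := by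
    refine ⟨(hf.measurable _ hf.mem).aestronglyMeasurable, ?_⟩
    rw [hasFiniteIntegral_iff_ofReal (ae_of_all _ fun z => hf.nonneg z _ hf.mem)]
    exact hfin
  refine (((hF.memLp_apply hh).integrable one_le_two).add hi0).congr (ae_of_all _ fun z => ?_)
  simp [excess]

lemma IsLearningProblem.ofReal_integral_loss (hf : IsLearningProblem P Θ f θs)
    [Nontrivial (Param p)] {M : 𝒵 → ℝ} {r : ℝ} (hr : 0 < r) (hball : Metric.ball θs r ⊆ Θ)
    (hF : IsLipFamily P (excess f θs) M r) {h : Param p} (hh : ‖h‖ < r) :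
    ENNReal.ofReal (∫ z, f z (θs + h) ∂P) = risk P f (θs + h) :=
  ofReal_integral_eq_lintegral_ofReal (hf.integrable_loss hr hball hF hh)
    (ae_of_all _ fun z => hf.nonneg z _ (hball (by simpa using hh)))

lemma IsLearningProblem.integral_excess (hf : IsLearningProblem P Θ f θs) [Nontrivial (Param p)]
    {M : 𝒵 → ℝ} {r : ℝ} (hr : 0 < r) (hball : Metric.ball θs r ⊆ Θ)
    (hF : IsLipFamily P (excess f θs) M r) {h : Param p} (hh : ‖h‖ < r) :
    ∫ z, excess f θs h z ∂P = (risk P f (θs + h)).toReal - (risk P f θs).toReal := by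
  have h0 : ‖(0 : Param p)‖ < r := by simpa
  have hn : ∀ {u : Param p}, ‖u‖ < r → 0 ≤ ∫ z, f z (θs + u) ∂P := fun hu =>
    integral_nonneg fun z => hf.nonneg z _ (hball (by simpa using hu))
  have h1 := hf.ofReal_integral_loss hr hball hF h0
  have h2 := hf.integrable_loss hr hball hF h0
  have h3 := hn h0
  rw [add_zero] at h1 h2 h3
  rw [← hf.ofReal_integral_loss hr hball hF hh, ← h1, ENNReal.toReal_ofReal (hn hh),
    ENNReal.toReal_ofReal h3, ← integral_sub (hf.integrable_loss hr hball hF hh) h2]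
  rfl

/-- The assumptions provide a local model. The Taylor expansion of the risk has no linear term and a
positive definite Hessian, because `θs` is a minimizer and the Hessian is nonsingular. -/
lemma IsLearningProblem.exists_isLocalModel [Nontrivial (Param p)]
    (hf : IsLearningProblem P Θ f θs) {ψ : 𝒵 → Param p}
    (hT : HasNonsingularTaylor (fun θ => (risk P f θ).toReal) θs)
    (hd : HasGradientAS P f θs ψ ∨ HasGradientInProb P f θs ψ)
    (hL : IsLipschitzNear P Θ f θs) :
    ∃ (r : ℝ) (M : 𝒵 → ℝ) (V : Param p →L[ℝ] Param p), Metric.ball θs r ⊆ Θ ∧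
      IsLocalModel P (excess f θs) M r ψ V := by
  obtain ⟨r, M, hr, hball, hF⟩ := hL.exists_isLipFamily hf
  obtain ⟨b, V, hVs, hVu, hVo⟩ := hT
  have hsub : HasSubseqGradient P (excess f θs) ψ :=
    hd.elim (fun h => h.hasSubseqGradient) fun h => h.hasSubseqGradient
  have hψ := hsub.memLp hF hr
  have hq := hsub.tendsto_quadraticMean hF hr
  have hnear : ∀ᶠ h : Param p in 𝓝 0, ‖h‖ < r := by
    filter_upwards [Metric.ball_mem_nhds (0 : Param p) hr] with h hh
    simpa using hh
  have hpos : ∀ᶠ h : Param p in 𝓝 0, 0 ≤ ∫ z, excess f θs h z ∂P := by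
    filter_upwards [hnear] with h hh
    rw [hf.integral_excess hr hball hF hh, sub_nonneg]
    rcases eq_or_ne h 0 with rfl | h0
    · simp
    refine ENNReal.toReal_mono ?_ (hf.unique_min _ (hball (by simpa using hh)) (by simpa)).le
    rw [← hf.ofReal_integral_loss hr hball hF hh]
    exact ENNReal.ofReal_ne_top
  have hexp : (fun h : Param p => ∫ z, excess f θs h z ∂P - inner ℝ b h -
      (1 / 2) * inner ℝ h (V h)) =o[𝓝 0] fun h => ‖h‖ ^ 2 := by
    refine hVo.congr' ?_ EventuallyEq.rfl
    filter_upwards [hnear] with h hh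
    rw [hf.integral_excess hr hball hF hh]
  have hsq : (fun h : Param p => ‖h‖ ^ 2) =o[𝓝 0] fun h : Param p => h :=
    Asymptotics.isLittleO_norm_pow_id one_lt_two
  have hquad : (fun h : Param p => (1 / 2) * inner ℝ h (V h)) =O[𝓝 0]
      fun h : Param p => ‖h‖ ^ 2 := by
    refine Asymptotics.IsBigO.of_bound ‖V‖ (Eventually.of_forall fun h => ?_)
    rw [norm_mul, norm_pow, norm_norm]
    calc ‖(1 / 2 : ℝ)‖ * ‖inner ℝ h (V h)‖ ≤ 1 * (‖h‖ * (‖V‖ * ‖h‖)) := by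
          refine mul_le_mul (by norm_num) ?_ (norm_nonneg _) zero_le_one
          exact (norm_inner_le_norm _ _).trans (by gcongr; exact V.le_opNorm h)
      _ = _ := by ring
  have hb : b = 0 := by
    refine eq_zero_of_isLittleO (ρ := fun h => ∫ z, excess f θs h z ∂P) (by simp [hF.zero]) hpos ?_
    have := (hexp.trans hsq).add (hquad.trans_isLittleO hsq)
    simpa using this
  have htaylor : (fun h : Param p => ∫ z, excess f θs h z ∂P -
      (1 / 2) * inner ℝ h (V h)) =o[𝓝 0] fun h => ‖h‖ ^ 2 := by
    simpa [hb] using hexp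
  have hsymm : ∀ u v : Param p, inner ℝ (V u) v = inner ℝ u (V v) := by
    intro u v
    conv_lhs => rw [← hVs.adjoint_eq]
    exact ContinuousLinearMap.adjoint_inner_left _ _ _
  exact ⟨r, M, V, hball, hr, hF, htaylor, hsymm, hVu,
    exists_coercive hsymm hVu (inner_nonneg_of_isLittleO hpos htaylor), hψ,
    integral_grad_eq_zero hF hr hψ hpos hq, hq⟩

end Problem

/-! ### Rate of convergence and asymptotic linearity -/

section Scaling

variable {p : ℕ} {𝒵 : Type*} [MeasurableSpace 𝒵] {P : Measure 𝒵} {F : Param p → 𝒵 → ℝ}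
  {M : 𝒵 → ℝ} {r : ℝ} {ψ : 𝒵 → Param p}

lemma empProc_const_mul (c : ℝ) (φ : 𝒵 → ℝ) {n : ℕ} (z : Fin n → 𝒵) :
    empProc P (fun y => c * φ y) z = c * empProc P φ z := by
  unfold empProc
  simp only [integral_const_mul, ← mul_sub, ← Finset.mul_sum]
  ring

lemma empProc_add {φ χ : 𝒵 → ℝ} (hφ : Integrable φ P) (hχ : Integrable χ P) {n : ℕ}
    (z : Fin n → 𝒵) : empProc P (fun y => φ y + χ y) z = empProc P φ z + empProc P χ z := by
  unfold empProc
  rw [integral_add hφ hχ, ← mul_add, ← Finset.sum_add_distrib]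
  congr 1
  exact Finset.sum_congr rfl fun i _ => by ring

lemma sum_eq_integral_add_empProc (φ : 𝒵 → ℝ) {n : ℕ} (hn : 0 < n) (z : Fin n → 𝒵) :
    ∑ i, φ (z i) = n * ∫ y, φ y ∂P + √n * empProc P φ z := by
  have : √(n : ℝ) ≠ 0 := (Real.sqrt_pos.2 (by exact_mod_cast hn)).ne'
  unfold empProc
  rw [← mul_assoc, mul_inv_cancel₀ this, one_mul, Finset.sum_sub_distrib]
  simp

/-- Rescaling the index and the values of a Lipschitz family preserves the Lipschitz
coefficient. -/
lemma IsLipFamily.scale (hF : IsLipFamily P F M r) {ρ : ℝ} (hρ : 0 < ρ) :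
    IsLipFamily P (fun u z => ρ⁻¹ * F (ρ • u) z) M (r / ρ) := by
  have hsm : ∀ {u : Param p}, ‖u‖ < r / ρ → ‖ρ • u‖ < r := fun hu => by
    rw [norm_smul, Real.norm_of_nonneg hρ.le, mul_comm]
    exact (lt_div_iff₀ hρ).1 hu
  refine ⟨fun u hu => (hF.aemeasurable _ (hsm hu)).const_mul _, fun z => by simp [hF.zero],
    hF.measurable, hF.nonneg, hF.memLp, ?_⟩
  filter_upwards [hF.lip] with z hz u v hu hv
  have h := hz _ _ (hsm hu) (hsm hv)
  rw [← smul_sub, norm_smul, Real.norm_of_nonneg hρ.le] at h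
  rw [← mul_sub, abs_mul, abs_of_pos (inv_pos.2 hρ), inv_mul_le_iff₀ hρ]
  linarith

/-- The linearization remainder of a Lipschitz family is again a Lipschitz family. -/
lemma IsLipFamily.exists_linRem (hF : IsLipFamily P F M r) (hψ : MemLp ψ 2 P) :
    ∃ M', IsLipFamily P (linRem F ψ) M' r := by
  have hm : AEMeasurable ψ P := hψ.1.aemeasurable
  refine ⟨fun z => M z + ‖hm.mk ψ z‖, fun u hu => ?_, fun z => by simp [linRem, hF.zero],
    hF.measurable.add hm.measurable_mk.norm, fun z => add_nonneg (hF.nonneg z) (norm_nonneg _),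
    hF.memLp.add (hψ.ae_eq hm.ae_eq_mk).norm, ?_⟩
  · exact (hF.aemeasurable u hu).sub (hm.inner aemeasurable_const)
  · filter_upwards [hF.lip, hm.ae_eq_mk] with z hz hz2 u v hu hv
    have h1 : linRem F ψ u z - linRem F ψ v z = (F u z - F v z) - inner ℝ (ψ z) (u - v) := by
      rw [linRem, linRem, inner_sub_right]; ring
    rw [h1, ← hz2, add_mul]
    exact (abs_sub _ _).trans (add_le_add (hz u v hu hv) (abs_real_inner_le_norm _ _))

end Scaling

section Rate

variable {p : ℕ} {𝒵 : Type*} [MeasurableSpace 𝒵] {P : Measure 𝒵} [IsProbabilityMeasure P]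
  {F : Param p → 𝒵 → ℝ} {M : 𝒵 → ℝ} {r : ℝ} {ψ : 𝒵 → Param p} {V : Param p →L[ℝ] Param p}
  {U : ∀ n : ℕ, (Fin n → 𝒵) → Param p}

omit [IsProbabilityMeasure P] in
/-- Quadratic growth of the mean near the minimizer. -/
lemma IsLocalModel.exists_quadratic_growth (hL : IsLocalModel P F M r ψ V) :
    ∃ c r₀ : ℝ, 0 < c ∧ 0 < r₀ ∧ ∀ h, ‖h‖ < r₀ → c * ‖h‖ ^ 2 ≤ ∫ z, F h z ∂P := by
  obtain ⟨c, hc, hV⟩ := hL.coercive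
  obtain ⟨r₀, hr₀, h⟩ := Metric.eventually_nhds_iff_ball.1
    (Asymptotics.isLittleO_iff.1 hL.taylor (by positivity : 0 < c / 4))
  refine ⟨c / 4, r₀, by positivity, hr₀, fun x hx => ?_⟩
  have h1 := h x (by simpa using hx)
  rw [Real.norm_eq_abs, norm_pow, norm_norm] at h1
  linarith [(abs_le.1 h1).1, hV x]

/-- On the shell of radius `ρ`, a value of the centred process above this threshold is unlikely. -/
lemma IsLipFamily.measure_shell_le (hF : IsLipFamily P F M r) {n : ℕ} (hn : 0 < n) {ρ : ℝ}
    (hρ : 0 < ρ) {t : ℝ} (ht : 0 ≤ t) :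
    (Measure.pi fun _ : Fin n => P) {z | ρ * (√p + 1) < r ∧ (∀ i, M (z i) ≤ √n) ∧
      ∃ h, ‖h‖ ≤ ρ ∧ ρ * (IsLipFamily.maxConst p (∫ z, M z ^ 2 ∂P) * (t + 1)) <
        |empProc P (F h) z|} ≤
      ENNReal.ofReal (2 * Real.exp ((∫ z, M z ^ 2 ∂P) / 4) * Real.exp (-t / 2)) := by
  by_cases hr : ρ * (√p + 1) < r
  · have hR : √p + 1 < r / ρ := by rw [lt_div_iff₀ hρ]; linarith
    refine le_trans (measure_mono ?_) ((hF.scale hρ).measure_exists_lt_abs_empProc_le hR hn ht)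
    rintro z ⟨-, hz, h, hh, hlt⟩
    refine ⟨hz, ρ⁻¹ • h, ?_, ?_⟩
    · rw [norm_smul, norm_inv, Real.norm_of_nonneg hρ.le, inv_mul_le_iff₀ hρ]
      linarith
    · rw [empProc_const_mul, smul_inv_smul₀ hρ.ne', abs_mul, abs_of_pos (inv_pos.2 hρ),
        lt_inv_mul_iff₀ hρ]
      exact hlt
  · simp [hr]

/-- An approximate minimizer that is consistent converges at rate `n^{-1/2}`. Dyadic shells
around the minimizer are excluded one by one: on the shell at distance `2ʲ n^{-1/2}` the mean excess
loss is of order `4ʲ / n`, and its fluctuations are of order `2ʲ / n`. -/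
lemma IsLocalModel.exists_rate (hL : IsLocalModel P F M r ψ V)
    (hcons : ∀ ε : ℝ, 0 < ε →
      Tendsto (fun n => (Measure.pi fun _ : Fin n => P) {z | ε ≤ ‖U n z‖}) atTop (𝓝 0))
    (hmin : ∀ ε : ℝ, 0 < ε → Tendsto (fun n => (Measure.pi fun _ : Fin n => P)
      {z | ¬ ∀ h, ‖h‖ < r → ∑ i, F (U n z) (z i) ≤ ∑ i, F h (z i) + ε}) atTop (𝓝 0))
    {δ : ℝ≥0∞} (hδ : 0 < δ) :
    ∃ K : ℝ, 0 < K ∧ ∀ᶠ n : ℕ in atTop,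
      (Measure.pi fun _ : Fin n => P) {z | K < √n * ‖U n z‖} ≤ δ := by
  obtain ⟨c, r₀, hc, hr₀, hgrow⟩ := hL.exists_quadratic_growth
  have hr := hL.pos
  set s := ∫ z, M z ^ 2 ∂P
  set κ := IsLipFamily.maxConst p s
  have hsp : 0 < √(p : ℝ) + 1 := by positivity
  set r₁ := min r₀ (r / (2 * (√p + 1)))
  have hr₁ : 0 < r₁ := lt_min hr₀ (by positivity)
  -- from some shell on, the mean dominates the fluctuations
  have hJ1 : ∀ᶠ j : ℕ in atTop, 1 + 2 ^ (j + 1) * (κ * (j + 1)) < c * 4 ^ j := by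
    have h2 := tendsto_pow_atTop_nhds_zero_of_lt_one (r := (1 / 2 : ℝ)) (by norm_num)
      (by norm_num)
    have h3 := tendsto_self_mul_const_pow_of_lt_one (r := (1 / 2 : ℝ)) (by norm_num)
      (by norm_num)
    have h4 := tendsto_pow_atTop_nhds_zero_of_lt_one (r := (1 / 4 : ℝ)) (by norm_num)
      (by norm_num)
    have h5 := h4.add ((h3.add h2).const_mul (2 * κ))
    rw [add_zero, mul_zero, add_zero] at h5
    filter_upwards [h5.eventually_lt_const hc] with j hj
    have h6 : (0 : ℝ) < 4 ^ j := by positivity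
    have h7 := mul_lt_mul_of_pos_right hj h6
    refine lt_of_eq_of_lt ?_ h7
    have h8 : (1 / 4 : ℝ) ^ j * 4 ^ j = 1 := by rw [← mul_pow]; norm_num
    have h9 : (1 / 2 : ℝ) ^ j * 4 ^ j = 2 ^ j := by rw [← mul_pow]; norm_num
    calc (1 : ℝ) + 2 ^ (j + 1) * (κ * (j + 1)) = 1 + 2 * κ * ((j + 1) * 2 ^ j) := by ring
      _ = (1 / 4 : ℝ) ^ j * 4 ^ j + 2 * κ * ((j + 1) * ((1 / 2 : ℝ) ^ j * 4 ^ j)) := by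
        rw [h8, h9]
      _ = _ := by ring
  let C : ℕ → ℝ≥0∞ := fun j => ENNReal.ofReal (2 * Real.exp (s / 4) * Real.exp (-(j : ℝ) / 2))
  have hCsum : ∑' j, C j ≠ ∞ := by
    have h1 : Summable fun j : ℕ => 2 * Real.exp (s / 4) * Real.exp (-(j : ℝ) / 2) := by
      refine Summable.mul_left _ ?_
      have h2 := summable_geometric_of_lt_one (r := Real.exp (-1 / 2)) (Real.exp_pos _).le
        (by rw [Real.exp_lt_one_iff]; norm_num)
      refine h2.congr fun j => ?_
      rw [← Real.exp_nat_mul]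
      congr 1; ring
    exact h1.tsum_ofReal_ne_top
  have hJ2 := ENNReal.tendsto_nhds_zero.1 (ENNReal.tendsto_sum_nat_add C hCsum) (δ / 2)
    (ENNReal.half_pos hδ.ne')
  obtain ⟨J₀, hJ₀⟩ := eventually_atTop.1 hJ1
  obtain ⟨J, hJ2, hJJ₀⟩ := (hJ2.and (eventually_ge_atTop J₀)).exists
  refine ⟨2 ^ J, by positivity, ?_⟩
  have htail : Tendsto (fun n => ENNReal.ofReal (tailSq P M n)) atTop (𝓝 0) := by
    simpa using ENNReal.tendsto_ofReal (tendsto_tailSq hL.lip.measurable hL.lip.memLp)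
  have hrest := ENNReal.tendsto_nhds_zero.1 (by
    simpa only [add_zero] using (hcons r₁ hr₁).add ((hmin 1 one_pos).add htail)) (δ / 2)
    (ENNReal.half_pos hδ.ne')
  filter_upwards [hrest, eventually_gt_atTop 0] with n hn1 hn
  have hn' : (0 : ℝ) < n := by exact_mod_cast hn
  have hsn : 0 < √(n : ℝ) := Real.sqrt_pos.2 hn'
  let ρ : ℕ → ℝ := fun j => 2 ^ (j + 1) / √n
  have hρ : ∀ j, 0 < ρ j := fun j => by positivity
  let B : ℕ → Set (Fin n → 𝒵) := fun j => {z | ρ j * (√p + 1) < r ∧ (∀ i, M (z i) ≤ √n) ∧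
    ∃ h, ‖h‖ ≤ ρ j ∧ ρ j * (κ * (j + 1)) < |empProc P (F h) z|}
  have hsub : {z : Fin n → 𝒵 | 2 ^ J < √n * ‖U n z‖} ⊆ (⋃ k, B (k + J)) ∪
      ({z | r₁ ≤ ‖U n z‖} ∪
        ({z | ¬ ∀ h, ‖h‖ < r → ∑ i, F (U n z) (z i) ≤ ∑ i, F h (z i) + 1} ∪
          {z | ¬ ∀ i, M (z i) ≤ √n})) := by
    intro z hz
    have hz' : 2 ^ J < √n * ‖U n z‖ := hz
    by_contra hcon
    rw [Set.mem_union, Set.mem_union, Set.mem_union, not_or, not_or, not_or] at hcon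
    obtain ⟨hc1, hc2, hc3, hc4⟩ := hcon
    have hU : ‖U n z‖ < r₁ := not_le.1 hc2
    have hm : ∀ h, ‖h‖ < r → ∑ i, F (U n z) (z i) ≤ ∑ i, F h (z i) + 1 := not_not.1 hc3
    have hz4 : ∀ i, M (z i) ≤ √n := not_not.1 hc4
    obtain ⟨j, hj1, hj2⟩ := exists_nat_pow_near
      ((one_le_pow₀ (one_le_two (α := ℝ))).trans hz'.le) (one_lt_two (α := ℝ))
    have hJj : J ≤ j := by
      have := (pow_lt_pow_iff_right₀ (one_lt_two (α := ℝ))).1 (hz'.trans hj2)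
      omega
    have hUρ : ‖U n z‖ ≤ ρ j := by
      rw [le_div_iff₀ hsn]; linarith
    have hρr : ρ j * (√p + 1) < r := by
      have h1 : ρ j ≤ 2 * ‖U n z‖ := by
        rw [div_le_iff₀ hsn, pow_succ]; linarith
      have h2 : ‖U n z‖ < r / (2 * (√p + 1)) := hU.trans_le (min_le_right _ _)
      rw [lt_div_iff₀ (by positivity)] at h2
      nlinarith
    have hemp : |empProc P (F (U n z)) z| ≤ ρ j * (κ * (j + 1)) := by
      by_contra! h
      refine hc1 (Set.mem_iUnion.2 ⟨j - J, ?_⟩)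
      rw [Nat.sub_add_cancel hJj]
      exact ⟨hρr, hz4, _, hUρ, h⟩
    have h0 := hm 0 (by simpa using hr)
    simp only [hL.lip.zero, Finset.sum_const_zero, zero_add] at h0
    rw [sum_eq_integral_add_empProc (P := P) _ hn] at h0
    have h1 := hgrow _ (hU.trans_le (min_le_left _ _))
    have h2 := mul_le_mul_of_nonneg_left h1 hn'.le
    have h3 := mul_le_mul_of_nonneg_left ((neg_le_neg hemp).trans (neg_abs_le _)) hsn.le
    have h4 : √n * (ρ j * (κ * (j + 1))) = 2 ^ (j + 1) * (κ * (j + 1)) := by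
      rw [← mul_assoc, mul_div_cancel₀ _ hsn.ne']
    have h5 : n * (c * ‖U n z‖ ^ 2) = c * (√n * ‖U n z‖) ^ 2 := by
      rw [mul_pow, Real.sq_sqrt hn'.le]; ring
    have h6 : c * 4 ^ j ≤ c * (√n * ‖U n z‖) ^ 2 := by
      have : (4 : ℝ) ^ j = (2 ^ j) ^ 2 := by rw [← pow_mul, mul_comm, pow_mul]; norm_num
      rw [this]
      gcongr
    have h7 := hJ₀ j (hJJ₀.trans hJj)
    linarith
  calc _ ≤ _ := measure_mono hsub
    _ ≤ _ := measure_union_le _ _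
    _ ≤ δ / 2 + δ / 2 := by
      refine add_le_add ?_ (le_trans ?_ hn1)
      · refine (measure_iUnion_le _).trans (le_trans (ENNReal.tsum_le_tsum fun k => ?_) hJ2)
        exact hL.lip.measure_shell_le hn (hρ _) (Nat.cast_nonneg _)
      · refine (measure_union_le _ _).trans (add_le_add_right ((measure_union_le _ _).trans ?_) _)
        exact add_le_add_right (measure_exists_lt_le hL.lip.measurable hL.lip.memLp n) _
    _ = δ := ENNReal.add_halves δ

/-- The normalized sum of the gradients. -/
noncomputable def score {n : ℕ} (ψ : 𝒵 → Param p) (z : Fin n → 𝒵) : Param p :=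
  (√n)⁻¹ • ∑ i, ψ (z i)

lemma empProc_inner_grad (hL : IsLocalModel P F M r ψ V) {n : ℕ} (z : Fin n → 𝒵)
    (h : Param p) : empProc P (fun y => inner ℝ (ψ y) h) z = inner ℝ (score ψ z) h := by
  unfold empProc score
  rw [integral_inner_grad hL.memLp_grad, hL.integral_grad, inner_zero_left, inner_smul_left,
    sum_inner]
  simp

/-- The normalized sum of the gradients is bounded in probability. -/
lemma IsLocalModel.exists_measure_score_le (hL : IsLocalModel P F M r ψ V) {δ : ℝ≥0∞}
    (hδ : 0 < δ) : ∃ K : ℝ, 0 < K ∧ ∀ n : ℕ,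
      (Measure.pi fun _ : Fin n => P) {z | K < ‖score ψ z‖} ≤ δ := by
  let e : Fin p → Param p := fun i => EuclideanSpace.single i 1
  have h1 : Tendsto (fun κ : ℝ => ∑ i, ENNReal.ofReal
      ((∫ z, (inner ℝ (ψ z) (e i)) ^ 2 ∂P) / κ ^ 2)) atTop (𝓝 0) := by
    have h0 : (0 : ℝ≥0∞) = ∑ _i : Fin p, 0 := by simp
    rw [h0]
    refine tendsto_finsetSum _ fun i _ => ?_
    have := ENNReal.tendsto_ofReal (Tendsto.const_div_atTop
      (tendsto_pow_atTop (α := ℝ) two_ne_zero) (∫ z, (inner ℝ (ψ z) (e i)) ^ 2 ∂P))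
    simpa using this
  obtain ⟨κ, hκ, hκ0⟩ := ((ENNReal.tendsto_nhds_zero.1 h1 δ hδ).and
    (eventually_gt_atTop 0)).exists
  refine ⟨(√p + 1) * κ, by positivity, fun n => ?_⟩
  have hsub : {z : Fin n → 𝒵 | (√p + 1) * κ < ‖score ψ z‖} ⊆
      ⋃ i ∈ Finset.univ, {z | κ ≤ |empProc P (fun y => inner ℝ (ψ y) (e i)) z|} := by
    intro z hz
    have hz' : (√p + 1) * κ < ‖score ψ z‖ := hz
    by_contra hcon
    simp only [Set.mem_iUnion, not_exists] at hcon
    have h2 : ∀ i, |score ψ z i| ≤ κ := fun i => by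
      have h3 : ¬ κ ≤ |empProc P (fun y => inner ℝ (ψ y) (e i)) z| := hcon i (Finset.mem_univ i)
      rw [empProc_inner_grad hL] at h3
      simp only [e, EuclideanSpace.inner_single_right] at h3
      simpa using (not_le.1 h3).le
    linarith [norm_le_sqrt_mul hκ0.le h2]
  refine (measure_mono hsub).trans ((measure_biUnion_finset_le _ _).trans (le_trans ?_ hκ))
  exact Finset.sum_le_sum fun i _ =>
    measure_le_abs_empProc_le (hL.memLp_grad.inner_const (e i)) hκ0

/-- Locally uniform quadratic approximation of the empirical excess loss. -/
lemma IsLocalModel.tendsto_measure_quadratic (hL : IsLocalModel P F M r ψ V) {K : ℝ} (hK : 0 < K)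
    {η : ℝ} (hη : 0 < η) :
    Tendsto (fun n : ℕ => (Measure.pi fun _ : Fin n => P) {z | ∃ h : Param p, ‖h‖ ≤ K ∧
      η < |∑ i, F ((√n)⁻¹ • h) (z i) - ((1 / 2) * inner ℝ h (V h) + inner ℝ (score ψ z) h)|})
      atTop (𝓝 0) := by
  obtain ⟨M', hM'⟩ := hL.lip.exists_linRem hL.memLp_grad
  let ρ : ℕ → ℝ := fun n => K * (√n)⁻¹
  have hρ0 : ∀ᶠ n in atTop, 0 < ρ n := by
    filter_upwards [eventually_gt_atTop 0] with n hn
    have hn' : (0 : ℝ) < n := by exact_mod_cast hn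
    positivity
  have hρlim : Tendsto ρ atTop (𝓝 0) := by
    have := ((tendsto_inv_atTop_zero.comp Real.tendsto_sqrt_atTop).comp
      tendsto_natCast_atTop_atTop).const_mul K
    simpa using this
  have hfam : ∀ᶠ n in atTop, IsLipFamily P (fun u z => (ρ n)⁻¹ * linRem F ψ (ρ n • u) z) M'
      (r / ρ n) := by
    filter_upwards [hρ0] with n hn
    exact hM'.scale hn
  have hsp : 0 < √(p : ℝ) + 1 := by positivity
  have hr := hL.pos
  have hR : ∀ᶠ n in atTop, √p + 1 < r / ρ n := by
    filter_upwards [hρ0, hρlim.eventually_lt_const (by positivity : 0 < r / (√p + 1))] with n h1 h2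
    rw [lt_div_iff₀ h1]
    rw [lt_div_iff₀ hsp] at h2
    linarith
  have hlim : ∀ u, Tendsto (fun n => ∫ z, ((ρ n)⁻¹ * linRem F ψ (ρ n • u) z) ^ 2 ∂P)
      atTop (𝓝 0) := by
    intro u
    rcases eq_or_ne u 0 with rfl | hu
    · simp [hM'.zero]
    have h1 : Tendsto (fun n => ρ n • u) atTop (𝓝[≠] 0) := by
      refine tendsto_nhdsWithin_iff.2 ⟨by simpa using hρlim.smul_const u, ?_⟩
      filter_upwards [hρ0] with n hn
      exact smul_ne_zero hn.ne' hu
    have h2 := (hL.quadraticMean.comp h1).const_mul (‖u‖ ^ 2)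
    rw [mul_zero] at h2
    refine h2.congr' ?_
    filter_upwards [hρ0] with n hn
    have hu' : ‖u‖ ≠ 0 := norm_ne_zero_iff.2 hu
    simp only [Function.comp_apply, mul_pow, norm_smul, Real.norm_eq_abs, sq_abs]
    rw [integral_const_mul]
    field_simp
  have hA := tendsto_measure_exists_lt_abs_empProc hfam hR hM'.measurable hM'.memLp hlim
    (by positivity : 0 < η / (2 * K))
  obtain ⟨r', hr', htay⟩ := Metric.eventually_nhds_iff_ball.1
    (Asymptotics.isLittleO_iff.1 hL.taylor (by positivity : 0 < η / (2 * K ^ 2)))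
  refine tendsto_of_tendsto_of_tendsto_of_le_of_le' tendsto_const_nhds hA
    (Eventually.of_forall fun _ => zero_le) ?_
  filter_upwards [hρ0, hρlim.eventually_lt_const hr', hρlim.eventually_lt_const hr,
    eventually_gt_atTop 0] with n hρn hρr' hρr hn
  have hn' : (0 : ℝ) < n := by exact_mod_cast hn
  have hsn : 0 < √(n : ℝ) := Real.sqrt_pos.2 hn'
  refine measure_mono ?_
  rintro z ⟨h, hhK, hlt⟩
  by_contra hcon
  have hu : ‖K⁻¹ • h‖ ≤ 1 := by
    rw [norm_smul, norm_inv, Real.norm_of_nonneg hK.le, inv_mul_le_iff₀ hK]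
    linarith
  have h1 : |empProc P (fun z => (ρ n)⁻¹ * linRem F ψ (ρ n • K⁻¹ • h) z) z| ≤ η / (2 * K) := by
    by_contra! hc
    exact hcon ⟨_, hu, hc⟩
  have hsm : ρ n • K⁻¹ • h = (√n)⁻¹ • h := by
    rw [smul_smul]
    congr 1
    simp only [ρ]
    field_simp
  set x : Param p := (√n)⁻¹ • h with hx
  have hxn : ‖x‖ = (√n)⁻¹ * ‖h‖ := by
    rw [hx, norm_smul, norm_inv, Real.norm_of_nonneg hsn.le]
  have hxρ : ‖x‖ ≤ ρ n := by
    rw [hxn, mul_comm]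
    simp only [ρ]
    gcongr
  rw [hsm, empProc_const_mul, abs_mul, abs_of_pos (inv_pos.2 hρn), inv_mul_le_iff₀ hρn] at h1
  have h2 : √n * |empProc P (linRem F ψ x) z| ≤ η / 2 := by
    calc √n * |empProc P (linRem F ψ x) z| ≤ √n * (ρ n * (η / (2 * K))) := by gcongr
      _ = η / 2 := by simp only [ρ]; field_simp
  have h3 := htay x (by simpa using hxρ.trans_lt hρr')
  rw [Real.norm_eq_abs, norm_pow, norm_norm] at h3
  have h4 : n * |∫ z, F x z ∂P - (1 / 2) * inner ℝ x (V x)| ≤ η / 2 := by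
    calc _ ≤ n * (η / (2 * K ^ 2) * ‖x‖ ^ 2) := by gcongr
      _ ≤ n * (η / (2 * K ^ 2) * ρ n ^ 2) := by gcongr
      _ = η / 2 := by
        simp only [ρ, mul_pow, inv_pow, Real.sq_sqrt hn'.le]; field_simp
  have h5 : empProc P (F x) z = empProc P (linRem F ψ x) z + (√n)⁻¹ * inner ℝ (score ψ z) h := by
    have hxr : ‖x‖ < r := hxρ.trans_lt hρr
    have : F x = fun y => linRem F ψ x y + inner ℝ (ψ y) x := by
      ext y; simp [linRem]
    rw [this, empProc_add ((memLp_linRem hL.lip hL.memLp_grad hxr).integrable one_le_two)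
      ((hL.memLp_grad.inner_const x).integrable one_le_two), empProc_inner_grad hL, hx,
      inner_smul_right]
  have h6 : n * ((1 / 2) * inner ℝ x (V x)) = (1 / 2) * inner ℝ h (V h) := by
    rw [hx, map_smul, inner_smul_left, inner_smul_right]
    simp only [conj_trivial]
    have : (n : ℝ) = √n * √n := (Real.mul_self_sqrt hn'.le).symm
    field_simp
    rw [Real.sq_sqrt hn'.le]
  have h7 : ∑ i, F x (z i) - ((1 / 2) * inner ℝ h (V h) + inner ℝ (score ψ z) h) =
      n * (∫ z, F x z ∂P - (1 / 2) * inner ℝ x (V x)) + √n * empProc P (linRem F ψ x) z := by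
    rw [sum_eq_integral_add_empProc (P := P) _ hn, h5, mul_sub, h6, mul_add, ← mul_assoc,
      mul_inv_cancel₀ hsn.ne']
    ring
  rw [h7] at hlt
  refine absurd hlt (not_lt.2 ((abs_add_le _ _).trans ?_))
  rw [abs_mul, abs_mul, abs_of_pos hn', abs_of_pos hsn]
  linarith

/-- Asymptotic linearity of a consistent approximate minimizer. Both it and the minimizer
`-V⁻¹ score` of the quadratic approximation almost minimize the empirical excess loss, and the
quadratic approximation grows quadratically away from its minimizer. -/
theorem IsLocalModel.asymptoticallyLinear (hL : IsLocalModel P F M r ψ V)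
    {W : Param p →L[ℝ] Param p} (hVW : ∀ h, V (W h) = h)
    (hcons : ∀ ε : ℝ, 0 < ε →
      Tendsto (fun n => (Measure.pi fun _ : Fin n => P) {z | ε ≤ ‖U n z‖}) atTop (𝓝 0))
    (hmin : ∀ ε : ℝ, 0 < ε → Tendsto (fun n => (Measure.pi fun _ : Fin n => P)
      {z | ¬ ∀ h, ‖h‖ < r → ∑ i, F (U n z) (z i) ≤ ∑ i, F h (z i) + ε}) atTop (𝓝 0))
    {ε : ℝ} (hε : 0 < ε) :
    Tendsto (fun n => (Measure.pi fun _ : Fin n => P)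
      {z | ε ≤ ‖√n • U n z + W (score ψ z)‖}) atTop (𝓝 0) := by
  obtain ⟨c, hc, hV⟩ := hL.coercive
  rw [ENNReal.tendsto_nhds_zero]
  intro δ hδ
  have hδ3 : 0 < δ / 2 := ENNReal.half_pos hδ.ne'
  have hδ4 : 0 < δ / 2 / 2 := ENNReal.half_pos hδ3.ne'
  obtain ⟨K₁, hK₁, hU⟩ := hL.exists_rate hcons hmin hδ4
  obtain ⟨K₂, hK₂, hS⟩ := hL.exists_measure_score_le hδ4
  set K := max K₁ ((‖W‖ + 1) * K₂)
  have hK : 0 < K := lt_max_of_lt_left hK₁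
  -- three errors `η` of the approximate minimization stay below the curvature term `c ε² / 2`
  set η := c * ε ^ 2 / 8
  have hη : 0 < η := by positivity
  have hr := hL.pos
  have hlim := ENNReal.tendsto_nhds_zero.1 (by
    simpa only [add_zero] using (hL.tendsto_measure_quadratic hK hη).add (hmin η hη)) (δ / 2) hδ3
  have hKn : ∀ᶠ n : ℕ in atTop, K * (√n)⁻¹ < r := by
    have := ((tendsto_inv_atTop_zero.comp Real.tendsto_sqrt_atTop).comp
      tendsto_natCast_atTop_atTop).const_mul K
    rw [mul_zero] at this
    exact this.eventually_lt_const hr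
  filter_upwards [hU, hlim, hKn, eventually_gt_atTop 0] with n hUn hlimn hKr hn
  have hn' : (0 : ℝ) < n := by exact_mod_cast hn
  have hsn : 0 < √(n : ℝ) := Real.sqrt_pos.2 hn'
  have hsub : {z : Fin n → 𝒵 | ε ≤ ‖√n • U n z + W (score ψ z)‖} ⊆
      ({z | K₁ < √n * ‖U n z‖} ∪ {z | K₂ < ‖score ψ z‖}) ∪
      ({z | ∃ h : Param p, ‖h‖ ≤ K ∧ η < |∑ i, F ((√n)⁻¹ • h) (z i) -
        ((1 / 2) * inner ℝ h (V h) + inner ℝ (score ψ z) h)|} ∪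
        {z | ¬ ∀ h, ‖h‖ < r → ∑ i, F (U n z) (z i) ≤ ∑ i, F h (z i) + η}) := by
    intro z hz
    have hz' : ε ≤ ‖√n • U n z + W (score ψ z)‖ := hz
    by_contra hcon
    rw [Set.mem_union, Set.mem_union, Set.mem_union, not_or, not_or, not_or] at hcon
    obtain ⟨⟨hc1, hc2⟩, hc3, hc4⟩ := hcon
    have h1 : √n * ‖U n z‖ ≤ K₁ := not_lt.1 hc1
    have h2 : ‖score ψ z‖ ≤ K₂ := not_lt.1 hc2
    have h3 : ∀ h : Param p, ‖h‖ ≤ K → |∑ i, F ((√n)⁻¹ • h) (z i) -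
        ((1 / 2) * inner ℝ h (V h) + inner ℝ (score ψ z) h)| ≤ η := by
      intro h hh
      by_contra! hlt
      exact hc3 ⟨h, hh, hlt⟩
    have h4 : ∀ h, ‖h‖ < r → ∑ i, F (U n z) (z i) ≤ ∑ i, F h (z i) + η := not_not.1 hc4
    set G := score ψ z
    set a := √n • U n z with ha
    set b := -W G with hb
    have hVb : V b = -G := by rw [hb, map_neg, hVW]
    have haK : ‖a‖ ≤ K := by
      rw [ha, norm_smul, Real.norm_of_nonneg hsn.le]
      exact h1.trans (le_max_left _ _)
    have hbK : ‖b‖ ≤ K := by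
      rw [hb, norm_neg]
      refine ((W.le_opNorm G).trans ?_).trans (le_max_right _ _)
      have := norm_nonneg W
      have := norm_nonneg G
      gcongr
      linarith
    have h5 := (abs_le.1 (h3 a haK)).1
    have h6 := (abs_le.1 (h3 b hbK)).2
    rw [ha, inv_smul_smul₀ hsn.ne', ← ha] at h5
    have h7 := h4 ((√n)⁻¹ • b) (by
      rw [norm_smul, norm_inv, Real.norm_of_nonneg hsn.le]
      refine lt_of_le_of_lt ?_ hKr
      rw [mul_comm]
      gcongr)
    -- completing the square
    have h8 : (1 / 2) * inner ℝ a (V a) + inner ℝ G a -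
        ((1 / 2) * inner ℝ b (V b) + inner ℝ G b) =
        (1 / 2) * inner ℝ (a - b) (V (a - b)) := by
      have h9 : inner ℝ b (V a) = -inner ℝ G a := by rw [← hL.symm, hVb, inner_neg_left]
      have h10 : inner ℝ a (V b) = -inner ℝ G a := by
        rw [hVb, inner_neg_right, real_inner_comm]
      have h11 : inner ℝ b (V b) = -inner ℝ G b := by
        rw [hVb, inner_neg_right, real_inner_comm]
      rw [map_sub, inner_sub_left, inner_sub_right, inner_sub_right, h9, h10, h11]
      ring
    have h12 := hV (a - b)
    have h13 : a - b = a + W G := by rw [hb, sub_neg_eq_add]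
    rw [h13] at h12 h8
    have h14 : c * ε ^ 2 ≤ c * ‖a + W G‖ ^ 2 := by gcongr
    have h15 : c * ε ^ 2 = 8 * η := by simp only [η]; ring
    linarith
  calc _ ≤ _ := measure_mono hsub
    _ ≤ _ := measure_union_le _ _
    _ ≤ (δ / 2 / 2 + δ / 2 / 2) + δ / 2 := by
      refine add_le_add ((measure_union_le _ _).trans (add_le_add hUn (hS n))) ?_
      exact (measure_union_le _ _).trans hlimn
    _ = δ := by rw [ENNReal.add_halves, ENNReal.add_halves]

end Rate

/-! ### The multivariate central limit theorem -/

section CLT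

variable {p : ℕ} {𝒵 : Type*} [MeasurableSpace 𝒵] {P : Measure 𝒵} {φ : 𝒵 → Param p}

/-- The matrix of second moments of a random vector. -/
noncomputable def secondMoment (P : Measure 𝒵) (φ : 𝒵 → Param p) : Matrix (Fin p) (Fin p) ℝ :=
  fun i j => ∫ z, φ z i * φ z j ∂P

lemma memLp_apply_coord (hφ : MemLp φ 2 P) (i : Fin p) : MemLp (fun z => φ z i) 2 P :=
  hφ.of_le ((EuclideanSpace.proj (𝕜 := ℝ) i).continuous.comp_aestronglyMeasurable hφ.1)
    (ae_of_all _ fun z => PiLp.norm_apply_le (φ z) i)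

lemma dotProduct_secondMoment (hφ : MemLp φ 2 P) (x : Fin p → ℝ) :
    x ⬝ᵥ (secondMoment P φ).mulVec x = ∫ z, (∑ i, x i * φ z i) ^ 2 ∂P := by
  have hi : ∀ i j, Integrable (fun z => x i * φ z i * (x j * φ z j)) P := fun i j =>
    ((memLp_apply_coord hφ i).const_mul (x i)).integrable_mul
      ((memLp_apply_coord hφ j).const_mul (x j))
  have h1 : ∀ z, (∑ i, x i * φ z i) ^ 2 = ∑ i, ∑ j, x i * φ z i * (x j * φ z j) := fun z => by
    rw [sq, Finset.sum_mul_sum]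
  simp_rw [h1]
  rw [integral_finsetSum _ fun i _ => integrable_finsetSum _ fun j _ => hi i j]
  simp_rw [fun i => integral_finsetSum (μ := P) Finset.univ fun j _ => hi i j]
  simp only [dotProduct, Matrix.mulVec, secondMoment, Finset.mul_sum]
  refine Finset.sum_congr rfl fun i _ => Finset.sum_congr rfl fun j _ => ?_
  rw [← integral_mul_const, ← integral_const_mul]
  congr with z
  ring

lemma posSemidef_secondMoment (hφ : MemLp φ 2 P) : (secondMoment P φ).PosSemidef := by
  refine .of_dotProduct_mulVec_nonneg ?_ fun x => ?_
  · ext i j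
    simp [secondMoment, mul_comm]
  · rw [star_trivial, dotProduct_secondMoment hφ]
    exact integral_nonneg fun z => sq_nonneg _

variable {Ω : Type*} [MeasurableSpace Ω] {μ : Measure Ω} [IsProbabilityMeasure μ]
  {Z : ℕ → Ω → 𝒵}

lemma variance_inner (hφ : MemLp φ 2 P) (h0 : ∫ z, φ z ∂P = 0) [IsProbabilityMeasure P]
    (t : Param p) : Var[fun z => inner ℝ t (φ z); P] = t ⬝ᵥ (secondMoment P φ).mulVec t := by
  rw [variance_of_integral_eq_zero (hφ.const_inner t).1.aemeasurable
    (by rw [integral_inner (𝕜 := ℝ) (hφ.integrable one_le_two), h0, inner_zero_right]),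
    dotProduct_secondMoment hφ]
  congr with z
  rw [PiLp.inner_apply]
  simp [mul_comm]

omit [IsProbabilityMeasure μ] in
lemma aemeasurable_normalized_sum (hZm : ∀ i, Measurable (Z i)) (hZP : ∀ i, μ.map (Z i) = P)
    (hφ : MemLp φ 2 P) (n : ℕ) :
    AEMeasurable (fun ω => (√n)⁻¹ • ∑ i : Fin n, φ (Z i ω)) μ := by
  have h : AEMeasurable (fun ω => ∑ i : Fin n, φ (Z i ω)) μ :=
    Finset.aemeasurable_fun_sum _ fun i _ =>
      AEMeasurable.comp_measurable (by rw [hZP]; exact hφ.1.aemeasurable) (hZm i)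
  exact (measurable_const_smul (√(n : ℝ))⁻¹).comp_aemeasurable h

/-- The one-dimensional central limit theorem for the projections to `t`. -/
lemma tendstoInDistribution_sum_inner [IsProbabilityMeasure P] (hZm : ∀ i, Measurable (Z i))
    (hZP : ∀ i, μ.map (Z i) = P) (hZi : iIndepFun Z μ) (hφ : MemLp φ 2 P)
    (h0 : ∫ z, φ z ∂P = 0) (t : Param p) :
    TendstoInDistribution (fun (n : ℕ) ω => (√n)⁻¹ * ∑ k ∈ Finset.range n, inner ℝ t (φ (Z k ω)))
      atTop (id : ℝ → ℝ) (fun _ => μ)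
      (gaussianReal 0 (t ⬝ᵥ (secondMoment P φ).mulVec t).toNNReal) := by
  have hg : AEMeasurable (fun z => inner ℝ t (φ z)) P := (hφ.const_inner t).1.aemeasurable
  have hid : ∀ i, IdentDistrib (fun ω => inner ℝ t (φ (Z i ω))) (fun z => inner ℝ t (φ z)) μ P := by
    intro i
    have h1 : IdentDistrib (Z i) id μ P :=
      ⟨(hZm i).aemeasurable, aemeasurable_id, by rw [hZP, Measure.map_id]⟩
    have h2 : AEMeasurable (fun z => inner ℝ t (φ z)) (μ.map (Z i)) := by rwa [hZP]
    exact h1.comp_of_aemeasurable h2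
  have hind : iIndepFun (fun i ω => inner ℝ t (φ (Z i ω))) μ :=
    hZi.comp₀ (fun _ z => inner ℝ t (φ z)) (fun i => (hZm i).aemeasurable)
      fun i => by rw [hZP]; exact hg
  have hX2 : MemLp (fun ω => inner ℝ t (φ (Z 0 ω))) 2 μ := (hid 0).memLp_iff.2 (hφ.const_inner t)
  have hmean : ∫ ω, inner ℝ t (φ (Z 0 ω)) ∂μ = 0 := by
    rw [(hid 0).integral_eq, integral_inner (𝕜 := ℝ) (hφ.integrable one_le_two), h0,
      inner_zero_right]
  have hvar : Var[fun ω => inner ℝ t (φ (Z 0 ω)); μ] = t ⬝ᵥ (secondMoment P φ).mulVec t := by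
    rw [(hid 0).variance_eq, variance_inner hφ h0]
  have hclt := tendstoInDistribution_inv_sqrt_mul_sum_sub
    (X := fun i ω => inner ℝ t (φ (Z i ω))) (Y := id)
    (P' := gaussianReal 0 Var[fun ω => inner ℝ t (φ (Z 0 ω)); μ].toNNReal)
    (P := μ) ⟨aemeasurable_id, Measure.map_id⟩ hX2 hind fun i => (hid i).trans (hid 0).symm
  simp only [hmean, mul_zero, sub_zero] at hclt
  rw [← hvar]
  exact hclt

/-- The central limit theorem in `ℝ^p`, from the one-dimensional theorem by convergence of
characteristic functions. -/
lemma tendstoInDistribution_sum [IsProbabilityMeasure P] (hZm : ∀ i, Measurable (Z i))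
    (hZP : ∀ i, μ.map (Z i) = P) (hZi : iIndepFun Z μ) (hφ : MemLp φ 2 P)
    (h0 : ∫ z, φ z ∂P = 0) :
    TendstoInDistribution (fun (n : ℕ) ω => (√n)⁻¹ • ∑ i : Fin n, φ (Z i ω)) atTop
      (id : Param p → Param p) (fun _ => μ) (multivariateGaussian 0 (secondMoment P φ)) := by
  have hm := aemeasurable_normalized_sum hZm hZP hφ
  refine ⟨hm, aemeasurable_id, ?_⟩
  refine ProbabilityMeasure.tendsto_iff_tendsto_charFun.2 fun t => ?_
  have hclt := tendstoInDistribution_sum_inner hZm hZP hZi hφ h0 t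
  have h1 := ProbabilityMeasure.tendsto_iff_tendsto_charFun.1 hclt.tendsto 1
  have hpos : 0 ≤ t ⬝ᵥ (secondMoment P φ).mulVec t := by
    rw [← variance_inner hφ h0]
    exact variance_nonneg _ _
  have hlim : charFun ((gaussianReal 0 (t ⬝ᵥ (secondMoment P φ).mulVec t).toNNReal).map id)
      (1 : ℝ) = charFun ((multivariateGaussian 0 (secondMoment P φ)).map id) t := by
    rw [Measure.map_id, Measure.map_id, charFun_gaussianReal,
      charFun_multivariateGaussian (posSemidef_secondMoment hφ)]
    congr 1
    simp [Real.coe_toNNReal _ hpos]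
  have hseq : ∀ n : ℕ, charFun (μ.map fun ω => (√n)⁻¹ * ∑ k ∈ Finset.range n,
      inner ℝ t (φ (Z k ω))) (1 : ℝ) =
      charFun (μ.map fun ω => (√n)⁻¹ • ∑ i : Fin n, φ (Z i ω)) t := by
    intro n
    rw [charFun_apply, charFun_apply, integral_map (hclt.forall_aemeasurable n) (by fun_prop),
      integral_map (hm n) (by fun_prop)]
    congr with ω
    congr 3
    rw [inner_smul_left, sum_inner, Finset.sum_range]
    simp [real_inner_comm]
  refine Tendsto.congr (fun n => hseq n) ?_
  change Tendsto _ _ (𝓝 (charFun ((multivariateGaussian 0 (secondMoment P φ)).map id) t))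
  rw [← hlim]
  exact h1

/-- A Gaussian law with a nondegenerate coordinate has no atom at `0`. -/
lemma multivariateGaussian_singleton_zero {S : Matrix (Fin p) (Fin p) ℝ} (hS : S.PosSemidef)
    {i : Fin p} (hi : S i i ≠ 0) : multivariateGaussian 0 S {0} = 0 := by
  have hmp := measurePreserving_eval_multivariateGaussian (μ := 0) hS (i := i)
  have hv : (S i i).toNNReal ≠ 0 := by
    rw [ne_eq, Real.toNNReal_eq_zero, not_le]
    exact lt_of_le_of_ne (hS.diag_nonneg) (Ne.symm hi)
  have := nullSingletonClass_gaussianReal (μ := (0 : Param p) i) hv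
  have h1 : multivariateGaussian 0 S ((fun x : Param p => x i) ⁻¹' {0}) = 0 := by
    rw [hmp.measure_preimage (measurableSet_singleton _).nullMeasurableSet]
    exact measure_singleton _
  refine measure_mono_null ?_ h1
  intro x hx
  have hx' : x = 0 := hx
  simp [hx']

/-- A sequence converging in distribution to a law without atom at `0` stays away from `0`. -/
lemma exists_measure_norm_le {X : ℕ → Ω → Param p} {ν : Measure (Param p)} [IsProbabilityMeasure ν]
    (hX : TendstoInDistribution X atTop (id : Param p → Param p) (fun _ => μ) ν) (hν : ν {0} = 0)
    {δ : ℝ≥0∞} (hδ : 0 < δ) :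
    ∃ κ : ℝ, 0 < κ ∧ ∀ᶠ n in atTop, μ {ω | ‖X n ω‖ ≤ κ} ≤ δ := by
  let B : ℕ → Set (Param p) := fun k => Metric.closedBall 0 (1 / ((k : ℝ) + 1))
  have hB : Tendsto (fun k => ν (B k)) atTop (𝓝 (ν (⋂ k, B k))) := by
    refine tendsto_measure_iInter_atTop
      (fun k => Metric.isClosed_closedBall.measurableSet.nullMeasurableSet) ?_
      ⟨0, measure_ne_top _ _⟩
    intro k l hkl
    exact Metric.closedBall_subset_closedBall (Nat.one_div_le_one_div hkl)
  have hI : ⋂ k, B k ⊆ {0} := by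
    intro x hx
    have h1 : ∀ k : ℕ, ‖x‖ ≤ 1 / ((k : ℝ) + 1) := fun k => by
      simpa [B] using Set.mem_iInter.1 hx k
    have h2 := ge_of_tendsto' tendsto_one_div_add_atTop_nhds_zero_nat h1
    exact norm_le_zero_iff.1 h2
  rw [measure_mono_null hI hν] at hB
  obtain ⟨k, hk⟩ := (hB.eventually_lt_const hδ).exists
  refine ⟨1 / ((k : ℝ) + 1), by positivity, ?_⟩
  have h3 := ProbabilityMeasure.limsup_measure_closed_le_of_tendsto hX.tendsto
    (Metric.isClosed_closedBall (x := (0 : Param p)) (ε := 1 / ((k : ℝ) + 1)))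
  have h4 : (ν.map id) (B k) < δ := by rwa [Measure.map_id]
  filter_upwards [eventually_lt_of_limsup_lt (h3.trans_lt h4)] with n hn
  refine le_trans (le_of_eq ?_) hn.le
  change _ = μ.map (X n) _
  rw [Measure.map_apply_of_aemeasurable (hX.forall_aemeasurable n)
    Metric.isClosed_closedBall.measurableSet]
  congr 1
  ext ω
  simp

end CLT

/-! ### Ratios of norms -/

section Ratio

variable {p : ℕ}

lemma exists_seminorm_bounds [Nontrivial (Param p)] (q : Seminorm ℝ (Param p))
    (hq : ∀ x, q x = 0 → x = 0) :
    ∃ c C : ℝ, 0 < c ∧ 0 < C ∧ ∀ x, c * ‖x‖ ≤ q x ∧ q x ≤ C * ‖x‖ := by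
  have hcont : ContinuousOn q (Metric.sphere (0 : Param p) 1) :=
    (q.convexOn.continuousOn isOpen_univ).mono (Set.subset_univ _)
  have hcpt := isCompact_sphere (0 : Param p) 1
  have hne : (Metric.sphere (0 : Param p) 1).Nonempty :=
    NormedSpace.sphere_nonempty.2 zero_le_one
  obtain ⟨x, hx, hmin⟩ := hcpt.exists_isMinOn hne hcont
  obtain ⟨y, hy, hmax⟩ := hcpt.exists_isMaxOn hne hcont
  have hpos : ∀ w ∈ Metric.sphere (0 : Param p) 1, 0 < q w := fun w hw => by
    refine lt_of_le_of_ne (apply_nonneg q w) fun h => ?_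
    have := hq w h.symm
    simp [this] at hw
  refine ⟨q x, q y, hpos x hx, hpos y hy, fun w => ?_⟩
  rcases eq_or_ne w 0 with rfl | hw
  · simp
  have hw' : 0 < ‖w‖ := norm_pos_iff.2 hw
  have hs : ‖w‖⁻¹ • w ∈ Metric.sphere (0 : Param p) 1 := by
    simp [norm_smul, hw'.ne']
  have h1 : q w = ‖w‖ * q (‖w‖⁻¹ • w) := by
    rw [map_smul_eq_mul, norm_inv, norm_norm, ← mul_assoc, mul_inv_cancel₀ hw'.ne', one_mul]
  rw [h1]
  have h2 : q x ≤ q (‖w‖⁻¹ • w) := hmin hs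
  have h3 : q (‖w‖⁻¹ • w) ≤ q y := hmax hs
  constructor <;> nlinarith

/-- Two sequences of random vectors with the same leading term, which stays away from zero, have
norms whose ratio tends to one. -/
lemma tendstoInMeasure_seminorm_div [Nontrivial (Param p)] {Ω : Type*} [MeasurableSpace Ω]
    {μ : Measure Ω} {q : Seminorm ℝ (Param p)} (hq : ∀ x, q x = 0 → x = 0)
    {a b X : ℕ → Ω → Param p}
    (ha : ∀ ε : ℝ, 0 < ε → Tendsto (fun n => μ {ω | ε ≤ ‖a n ω - X n ω‖}) atTop (𝓝 0))
    (hb : ∀ ε : ℝ, 0 < ε → Tendsto (fun n => μ {ω | ε ≤ ‖b n ω - X n ω‖}) atTop (𝓝 0))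
    (hX : ∀ δ : ℝ≥0∞, 0 < δ → ∃ κ : ℝ, 0 < κ ∧ ∀ᶠ n in atTop, μ {ω | ‖X n ω‖ ≤ κ} ≤ δ) :
    TendstoInMeasure μ (fun n ω => q (a n ω) / q (b n ω)) atTop fun _ => (1 : ℝ) := by
  obtain ⟨c, C, hc, hC, hcC⟩ := exists_seminorm_bounds q hq
  rw [tendstoInMeasure_iff_norm]
  intro ε hε
  rw [ENNReal.tendsto_nhds_zero]
  intro δ hδ
  obtain ⟨κ, hκ, hXκ⟩ := hX (δ / 2) (ENNReal.half_pos hδ.ne')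
  set τ := min (κ / 2) (ε * c * κ / (8 * C))
  have hτ : 0 < τ := lt_min (by positivity) (by positivity)
  have hlim := ENNReal.tendsto_nhds_zero.1 (by
    simpa only [add_zero] using (ha τ hτ).add (hb τ hτ)) (δ / 2) (ENNReal.half_pos hδ.ne')
  filter_upwards [hXκ, hlim] with n hXn hn
  have hsub : {ω | ε ≤ ‖q (a n ω) / q (b n ω) - 1‖} ⊆ {ω | ‖X n ω‖ ≤ κ} ∪
      ({ω | τ ≤ ‖a n ω - X n ω‖} ∪ {ω | τ ≤ ‖b n ω - X n ω‖}) := by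
    intro ω hω
    have hω' : ε ≤ ‖q (a n ω) / q (b n ω) - 1‖ := hω
    by_contra hcon
    rw [Set.mem_union, Set.mem_union, not_or, not_or] at hcon
    have h1 : κ < ‖X n ω‖ := not_le.1 hcon.1
    have h2 : ‖a n ω - X n ω‖ < τ := not_le.1 hcon.2.1
    have h3 : ‖b n ω - X n ω‖ < τ := not_le.1 hcon.2.2
    have hτ1 : τ ≤ κ / 2 := min_le_left _ _
    have hτ2 : τ ≤ ε * c * κ / (8 * C) := min_le_right _ _
    have h4 : κ / 2 < ‖b n ω‖ := by
      have := norm_sub_norm_le (X n ω) (b n ω)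
      rw [norm_sub_rev] at this
      linarith
    have h5 : c * (κ / 2) < q (b n ω) :=
      (mul_lt_mul_of_pos_left h4 hc).trans_le (hcC _).1
    have h6 : 0 < q (b n ω) := lt_trans (by positivity) h5
    have h7 : ‖a n ω - b n ω‖ ≤ 2 * τ := by
      have : a n ω - b n ω = (a n ω - X n ω) - (b n ω - X n ω) := by abel
      rw [this]
      linarith [norm_sub_le (a n ω - X n ω) (b n ω - X n ω)]
    have h8 : |q (a n ω) - q (b n ω)| ≤ C * (2 * τ) :=
      (abs_sub_map_le_sub q _ _).trans ((hcC _).2.trans (by gcongr))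
    have h9 : C * (2 * τ) ≤ ε * (c * κ / 4) := by
      calc C * (2 * τ) ≤ C * (2 * (ε * c * κ / (8 * C))) := by gcongr
        _ = _ := by field_simp; norm_num
    rw [div_sub_one h6.ne', Real.norm_eq_abs, abs_div, abs_of_pos h6, le_div_iff₀ h6] at hω'
    have h10 : ε * (c * (κ / 2)) < ε * q (b n ω) := by gcongr
    have h11 : 0 < ε * (c * κ) := by positivity
    linarith
  calc _ ≤ _ := measure_mono hsub
    _ ≤ _ := measure_union_le _ _
    _ ≤ δ / 2 + δ / 2 := add_le_add hXn ((measure_union_le _ _).trans hn)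
    _ = δ := ENNReal.add_halves δ

end Ratio

/-! ### Transfer to allocated samples -/

section Allocation

variable {𝒵 : Type*} [MeasurableSpace 𝒵] {P : Measure 𝒵} {Ω : Type*} [MeasurableSpace Ω]
  {μ : Measure Ω} {Z : ℕ → Ω → 𝒵}

lemma map_sample (hZm : ∀ i, Measurable (Z i)) (hZP : ∀ i, μ.map (Z i) = P)
    (hZi : iIndepFun Z μ) {n : ℕ} {e : Fin n → ℕ} (he : Function.Injective e) :
    μ.map (fun ω i => Z (e i) ω) = Measure.pi fun _ : Fin n => P := by
  rw [(hZi.precomp he).map_fun_eq_pi_map fun i => (hZm (e i)).aemeasurable]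
  simp_rw [hZP]

/-- An inequality suffices for upper bounds, and it holds for sets that need not be measurable. -/
lemma measure_sample_mem_le (hZm : ∀ i, Measurable (Z i)) (hZP : ∀ i, μ.map (Z i) = P)
    (hZi : iIndepFun Z μ) {n : ℕ} (S : Set (Fin n → 𝒵)) :
    μ {ω | (fun i : Fin n => Z i ω) ∈ S} ≤ (Measure.pi fun _ : Fin n => P) S := by
  have hm : Measurable fun ω (i : Fin n) => Z i ω := measurable_pi_lambda _ fun i => hZm i
  rw [← map_sample hZm hZP hZi (n := n) Fin.val_injective]
  exact Measure.le_map_apply hm.aemeasurable S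

/-- The sample of one machine has the law of an i.i.d. sample, conditionally on the allocation. The
inequality holds for sets that need not be measurable. -/
lemma measure_allocated_mem_le [IsProbabilityMeasure μ] (hZm : ∀ i, Measurable (Z i))
    (hZP : ∀ i, μ.map (Z i) = P) (hZi : iIndepFun Z μ) {m : ℕ}
    {A : ∀ n : ℕ, Ω → (Fin m × Fin n ≃ Fin (m * n))} (hA : IsAllocation μ Z m A) (n : ℕ)
    (j : Fin m) (S : Set (Fin n → 𝒵)) :
    μ {ω | (fun i : Fin n => Z (A n ω (j, i)) ω) ∈ S} ≤ (Measure.pi fun _ : Fin n => P) S := by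
  classical
  set Q := Measure.pi fun _ : Fin n => P
  let S' := toMeasurable Q S
  have hS' : MeasurableSet S' := measurableSet_toMeasurable _ _
  -- only finitely many allocations are possible, so one can condition on their values
  have hmA : ∀ σ, MeasurableSet (A n ⁻¹' {σ}) := fun σ =>
    hA.measurable n (MeasurableSpace.measurableSet_top (s := {σ}))
  have hdata : ∀ σ : Fin m × Fin n ≃ Fin (m * n),
      μ {ω | (fun i : Fin n => Z (σ (j, i)) ω) ∈ S'} = Q S' := by
    intro σ
    have he : Function.Injective fun i : Fin n => (σ (j, i) : ℕ) := fun a b hab => by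
      simpa using σ.injective (Fin.val_injective hab)
    have hm : Measurable fun ω (i : Fin n) => Z (σ (j, i)) ω :=
      measurable_pi_lambda _ fun i => hZm _
    have h := Measure.map_apply (μ := μ) hm hS'
    rw [map_sample hZm hZP hZi he] at h
    exact h.symm
  have hind : ∀ σ, μ (A n ⁻¹' {σ} ∩ {ω | (fun i : Fin n => Z (σ (j, i)) ω) ∈ S'}) =
      μ (A n ⁻¹' {σ}) * Q S' := by
    intro σ
    rw [← hdata σ]
    refine (Indep_iff _ _ μ).1 (hA.indep n) _ _ ⟨{σ}, MeasurableSpace.measurableSet_top, rfl⟩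
      ⟨{x : ℕ → 𝒵 | (fun i : Fin n => x (σ (j, i))) ∈ S'}, ?_, rfl⟩
    exact (measurable_pi_lambda _ fun i => measurable_pi_apply _ :
      Measurable fun (x : ℕ → 𝒵) (i : Fin n) => x (σ (j, i))) hS'
  have hsub : {ω | (fun i : Fin n => Z (A n ω (j, i)) ω) ∈ S} ⊆
      ⋃ σ ∈ Finset.univ, A n ⁻¹' {σ} ∩ {ω | (fun i : Fin n => Z (σ (j, i)) ω) ∈ S'} := by
    intro ω hω
    exact Set.mem_biUnion (Finset.mem_univ (A n ω)) ⟨rfl, subset_toMeasurable _ _ hω⟩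
  have hone : ∑ σ, μ (A n ⁻¹' {σ}) ≤ 1 := by
    rw [← measure_biUnion_finset (fun σ _ τ _ hστ => ?_) fun σ _ => hmA σ]
    · exact prob_le_one
    · refine Set.disjoint_left.2 fun ω hω hω' => hστ ?_
      have h1 : A n ω = σ := hω
      have h2 : A n ω = τ := hω'
      rw [← h1, h2]
  calc _ ≤ _ := measure_mono hsub
    _ ≤ _ := measure_biUnion_finset_le _ _
    _ = (∑ σ, μ (A n ⁻¹' {σ})) * Q S' := by
      rw [Finset.sum_mul]
      exact Finset.sum_congr rfl fun σ _ => hind σ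
    _ ≤ 1 * Q S' := by gcongr
    _ = Q S := by rw [one_mul, measure_toMeasurable]

end Allocation

/-! ### Asymptotic linearity of M-estimators -/

section Estimators

variable {p : ℕ} {𝒵 : Type*} [MeasurableSpace 𝒵] {P : Measure 𝒵} {Θ : Set (Param p)}
  {f : 𝒵 → Param p → ℝ} {θs : Param p} {T : ∀ n : ℕ, (Fin n → 𝒵) → Param p}

/-- The minimization property in terms of sums of excess losses, where the error `o_P(1/n)` of the
means becomes `o_P(1)`. -/
lemma IsMEstimator.tendsto_excess (hT : IsMEstimator P Θ f T) {r : ℝ}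
    (hball : Metric.ball θs r ⊆ Θ) {ε : ℝ} (hε : 0 < ε) :
    Tendsto (fun n => (Measure.pi fun _ : Fin n => P) {z | ¬ ∀ h, ‖h‖ < r →
      ∑ i, excess f θs (T n z - θs) (z i) ≤ ∑ i, excess f θs h (z i) + ε}) atTop (𝓝 0) := by
  refine tendsto_of_tendsto_of_tendsto_of_le_of_le' tendsto_const_nhds (hT.minimizes ε hε)
    (Eventually.of_forall fun _ => zero_le) ?_
  filter_upwards [eventually_gt_atTop 0] with n hn
  have hn' : (0 : ℝ) < n := by exact_mod_cast hn
  refine measure_mono fun z hz hz2 => hz fun h hh => ?_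
  have h1 := hz2.2 (θs + h) (hball (by simpa using hh))
  unfold empRisk at h1
  have h2 := mul_le_mul_of_nonneg_left h1 hn'.le
  rw [mul_add, mul_inv_cancel_left₀ hn'.ne', mul_inv_cancel_left₀ hn'.ne',
    mul_div_cancel₀ _ hn'.ne'] at h2
  simp only [excess, add_sub_cancel, Finset.sum_sub_distrib]
  linarith

variable [IsProbabilityMeasure P] {ψ : 𝒵 → Param p}

/-- The M-estimator is asymptotically linear: up to `o_P(n^{-1/2})`, its error is the mean of the
observations of an explicit function, which is centred, square integrable and not zero. -/
lemma exists_asymptoticallyLinear [Nontrivial (Param p)] (hf : IsLearningProblem P Θ f θs)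
    (hT : IsMEstimator P Θ f T) (hA : FirstOrderAssumptions P Θ f θs ψ T)
    (hψ : ¬ ∀ᵐ z ∂P, ψ z = 0) :
    ∃ φ : 𝒵 → Param p, MemLp φ 2 P ∧ ∫ z, φ z ∂P = 0 ∧ (¬ ∀ᵐ z ∂P, φ z = 0) ∧
      ∀ ε : ℝ, 0 < ε → Tendsto (fun n => (Measure.pi fun _ : Fin n => P)
        {z | ε ≤ ‖√n • (T n z - θs) - (√n)⁻¹ • ∑ i, φ (z i)‖}) atTop (𝓝 0) := by
  obtain ⟨r, M, V, hball, hL⟩ := hf.exists_isLocalModel hA.taylor hA.differentiable hA.lipschitz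
  obtain ⟨W, hW⟩ := hL.isUnit.exists_right_inv
  have hVW : ∀ h, V (W h) = h := fun h => by simpa using DFunLike.congr_fun hW h
  have hlin := fun (ε : ℝ) (hε : 0 < ε) =>
    hL.asymptoticallyLinear (U := fun n z => T n z - θs) hVW hA.consistent
      (fun ε hε => hT.tendsto_excess hball hε) hε
  refine ⟨fun z => -W (ψ z), (W.comp_memLp' hL.memLp_grad).neg, ?_, fun h => hψ ?_,
    fun ε hε => ?_⟩
  · rw [integral_neg, W.integral_comp_comm (hL.memLp_grad.integrable one_le_two),
      hL.integral_grad, map_zero, neg_zero]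
  · filter_upwards [h] with z hz
    rw [← hVW (ψ z), neg_eq_zero.1 hz, map_zero]
  · refine (hlin ε hε).congr fun n => ?_
    congr with z
    rw [score, map_smul, map_sum, Finset.sum_neg_distrib, smul_neg, sub_neg_eq_add]

end Estimators

end SplitAverage

/-! ### Averaging compared with centralizing -/

open SplitAverage in
theorem mainTheorem1 {p m : ℕ} (hm : 0 < m)
    {𝒵 : Type*} [MeasurableSpace 𝒵] (P : Measure 𝒵) [IsProbabilityMeasure P]
    (Θ : Set (SplitAverage.Param p)) (f : 𝒵 → SplitAverage.Param p → ℝ)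
    (θs : SplitAverage.Param p) (ψ : 𝒵 → SplitAverage.Param p)
    (T : ∀ n : ℕ, (Fin n → 𝒵) → SplitAverage.Param p)
    (hf : SplitAverage.IsLearningProblem P Θ f θs)
    (hT : SplitAverage.IsMEstimator P Θ f T)
    (hA : SplitAverage.FirstOrderAssumptions P Θ f θs ψ T)
    (hψ : ¬ ∀ᵐ z ∂P, ψ z = 0)
    {Ω : Type*} [MeasurableSpace Ω] (μ : Measure Ω) [IsProbabilityMeasure μ]
    (Z : ℕ → Ω → 𝒵) (hZm : ∀ i, Measurable (Z i)) (hZP : ∀ i, μ.map (Z i) = P)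
    (hZi : iIndepFun Z μ)
    (A : ∀ n : ℕ, Ω → (Fin m × Fin n ≃ Fin (m * n)))
    (hAlloc : SplitAverage.IsAllocation μ Z m A) :
    (∀ ν : Seminorm ℝ (SplitAverage.Param p), (∀ x, ν x = 0 → x = 0) →
      TendstoInMeasure μ
        (fun n ω => ν (SplitAverage.averaged T Z A n ω - θs) /
          ν (SplitAverage.centralized T Z (m * n) ω - θs))
        atTop (fun _ => (1 : ℝ))) ∧
    SplitAverage.FirstOrderEquivalent μ θs (fun n => Real.sqrt ((m * n : ℕ) : ℝ))
      (SplitAverage.averaged T Z A) (fun n => SplitAverage.centralized T Z (m * n)) := by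
  have hm' : (0 : ℝ) < m := by exact_mod_cast hm
  -- in dimension zero the gradient would vanish
  have hnt : Nontrivial (Param p) := by
    by_contra h
    rw [not_nontrivial_iff_subsingleton] at h
    exact hψ (ae_of_all _ fun z => Subsingleton.elim _ _)
  obtain ⟨φ, hφ, hφ0, hφne, hlin⟩ := exists_asymptoticallyLinear hf hT hA hψ
  have hmn : Tendsto (fun n : ℕ => m * n) atTop atTop := tendsto_id.const_mul_atTop' hm
  -- the common leading term, multiplied by `√(m n)`
  let X : ℕ → Ω → Param p := fun n ω => (√((m * n : ℕ) : ℝ))⁻¹ • ∑ i : Fin (m * n), φ (Z i ω)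
  -- the errors of the linearizations of the single machines
  let D : Fin m → ℕ → Ω → Param p := fun j n ω => √n • (machine T Z A j n ω - θs) -
    (√n)⁻¹ • ∑ i : Fin n, φ (Z (A n ω (j, i)) ω)
  have hcen : ∀ ε : ℝ, 0 < ε → Tendsto (fun n => μ {ω | ε ≤
      ‖√((m * n : ℕ) : ℝ) • (centralized T Z (m * n) ω - θs) - X n ω‖}) atTop (𝓝 0) := by
    intro ε hε
    refine tendsto_of_tendsto_of_tendsto_of_le_of_le tendsto_const_nhds ((hlin ε hε).comp hmn)
      (fun _ => zero_le) fun n => ?_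
    exact measure_sample_mem_le hZm hZP hZi {z : Fin (m * n) → 𝒵 | ε ≤
      ‖√((m * n : ℕ) : ℝ) • (T (m * n) z - θs) - (√((m * n : ℕ) : ℝ))⁻¹ • ∑ i, φ (z i)‖}
  have hmach : ∀ j, ∀ ε : ℝ, 0 < ε → Tendsto (fun n => μ {ω | ε ≤ ‖D j n ω‖}) atTop (𝓝 0) := by
    intro j ε hε
    refine tendsto_of_tendsto_of_tendsto_of_le_of_le tendsto_const_nhds (hlin ε hε)
      (fun _ => zero_le) fun n => ?_
    exact measure_allocated_mem_le hZm hZP hZi hAlloc n j {z : Fin n → 𝒵 | ε ≤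
      ‖√n • (T n z - θs) - (√n)⁻¹ • ∑ i, φ (z i)‖}
  -- every observation belongs to exactly one machine, so the linear terms add up
  have havg_eq : ∀ n ω, √((m * n : ℕ) : ℝ) • (averaged T Z A n ω - θs) - X n ω =
      (√m)⁻¹ • ∑ j, D j n ω := by
    intro n ω
    have hsm : 0 < √(m : ℝ) := Real.sqrt_pos.2 hm'
    have h1 : ∑ i : Fin (m * n), φ (Z i ω) = ∑ j, ∑ i : Fin n, φ (Z (A n ω (j, i)) ω) := by
      rw [← Equiv.sum_comp (A n ω), Fintype.sum_prod_type]
    have h2 : averaged T Z A n ω - θs = (m : ℝ)⁻¹ • ∑ j, (machine T Z A j n ω - θs) := by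
      rw [averaged, Finset.sum_sub_distrib, smul_sub, Finset.sum_const, Finset.card_univ,
        Fintype.card_fin, ← Nat.cast_smul_eq_nsmul ℝ, smul_smul, inv_mul_cancel₀ hm'.ne', one_smul]
    have h3 : √((m * n : ℕ) : ℝ) = √m * √n := by
      rw [Nat.cast_mul, Real.sqrt_mul hm'.le]
    have h4 : √(m : ℝ) * √n * (m : ℝ)⁻¹ = (√m)⁻¹ * √n := by
      have : (m : ℝ)⁻¹ = (√m)⁻¹ * (√m)⁻¹ := by
        rw [← mul_inv, Real.mul_self_sqrt hm'.le]
      rw [this]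
      field_simp
    have h5 : ∑ j, D j n ω = √n • ∑ j, (machine T Z A j n ω - θs) -
        (√n)⁻¹ • ∑ j, ∑ i : Fin n, φ (Z (A n ω (j, i)) ω) := by
      rw [Finset.smul_sum, Finset.smul_sum, ← Finset.sum_sub_distrib]
    rw [h5, h2]
    simp only [X]
    rw [h1, h3, smul_sub, smul_smul, smul_smul, smul_smul, h4, mul_inv]
  have havg : ∀ ε : ℝ, 0 < ε → Tendsto (fun n => μ {ω | ε ≤
      ‖√((m * n : ℕ) : ℝ) • (averaged T Z A n ω - θs) - X n ω‖}) atTop (𝓝 0) := by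
    intro ε hε
    have hsum : Tendsto (fun n => ∑ j, μ {ω | ε / m ≤ ‖D j n ω‖}) atTop (𝓝 0) := by
      have h0 : (0 : ℝ≥0∞) = ∑ _j : Fin m, 0 := by simp
      rw [h0]
      exact tendsto_finsetSum _ fun j _ => hmach j _ (by positivity)
    refine tendsto_of_tendsto_of_tendsto_of_le_of_le tendsto_const_nhds hsum
      (fun _ => zero_le) fun n => ?_
    refine (measure_mono ?_).trans (measure_biUnion_finset_le Finset.univ _)
    intro ω hω
    have hω' : ε ≤ ‖√((m * n : ℕ) : ℝ) • (averaged T Z A n ω - θs) - X n ω‖ := hω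
    by_contra hcon
    simp only [Set.mem_iUnion, not_exists] at hcon
    have h1 : ∀ j, ‖D j n ω‖ < ε / m := fun j => not_le.1 (hcon j (Finset.mem_univ j))
    have h2 : (√(m : ℝ))⁻¹ ≤ 1 := by
      refine inv_le_one_of_one_le₀ (Real.one_le_sqrt.2 ?_)
      exact_mod_cast hm
    have h3 : ‖∑ j, D j n ω‖ < ε := by
      have : Nonempty (Fin m) := ⟨⟨0, hm⟩⟩
      refine (norm_sum_le _ _).trans_lt ?_
      calc ∑ j, ‖D j n ω‖ < ∑ _j : Fin m, ε / m :=
            Finset.sum_lt_sum_of_nonempty Finset.univ_nonempty fun j _ => h1 j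
        _ = ε := by simp; field_simp
    rw [havg_eq, norm_smul, norm_inv, Real.norm_of_nonneg (Real.sqrt_nonneg _)] at hω'
    have h4 : (√(m : ℝ))⁻¹ * ‖∑ j, D j n ω‖ ≤ 1 * ‖∑ j, D j n ω‖ := by gcongr
    linarith
  set ν := multivariateGaussian 0 (secondMoment P φ)
  have hclt : TendstoInDistribution X atTop (id : Param p → Param p) (fun _ => μ) ν := by
    have h := tendstoInDistribution_sum hZm hZP hZi hφ hφ0
    exact ⟨fun n => h.forall_aemeasurable (m * n), h.aemeasurable_limit, h.tendsto.comp hmn⟩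
  have hν0 : ν {0} = 0 := by
    obtain ⟨i, hi⟩ : ∃ i, secondMoment P φ i i ≠ 0 := by
      by_contra! h
      refine hφne ?_
      have h1 : ∀ i, ∀ᵐ z ∂P, φ z i = 0 := fun i => by
        have h2 := memLp_apply_coord hφ i
        have h3 : ∫ z, φ z i ^ 2 ∂P = 0 := by
          simp only [sq]
          exact h i
        have h4 := (integral_eq_zero_iff_of_nonneg (fun z => sq_nonneg (φ z i))
          h2.integrable_sq).1 h3
        filter_upwards [h4] with z hz
        exact pow_eq_zero_iff two_ne_zero |>.1 hz
      filter_upwards [ae_all_iff.2 h1] with z hz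
      ext i
      exact hz i
    exact multivariateGaussian_singleton_zero (posSemidef_secondMoment hφ) hi
  have hνne : ν ≠ Measure.dirac 0 := by
    intro h
    rw [h] at hν0
    simp at hν0
  have hsqrt : ∀ᶠ n : ℕ in atTop, 0 < √((m * n : ℕ) : ℝ) := by
    filter_upwards [eventually_gt_atTop 0] with n hn
    exact Real.sqrt_pos.2 (by exact_mod_cast Nat.mul_pos hm hn)
  refine ⟨fun q hq => ?_, ?_, ?_⟩
  · have h := tendstoInMeasure_seminorm_div hq havg hcen
      fun δ hδ => exists_measure_norm_le hclt hν0 hδ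
    refine h.congr' ?_ EventuallyEq.rfl
    filter_upwards [hsqrt] with n hn
    refine ae_of_all _ fun ω => ?_
    simp only [map_smul_eq_mul]
    exact mul_div_mul_left _ _ (norm_ne_zero_iff.2 hn.ne')
  · exact Real.tendsto_sqrt_atTop.comp (tendsto_natCast_atTop_atTop.comp hmn)
  · let L : ℕ → Ω → Param p := fun n ω => (√((m * n : ℕ) : ℝ))⁻¹ • X n ω
    have hL : ∀ n ω, √((m * n : ℕ) : ℝ) • L n ω = X n ω := by
      intro n ω
      rcases eq_or_ne (√((m * n : ℕ) : ℝ)) 0 with h | h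
      · -- for `n = 0` both sides are the empty sum
        simp only [L, X, h, inv_zero, zero_smul]
      · simp only [L, smul_inv_smul₀ h]
    have hlead : ∀ U : ℕ → Ω → Param p, (∀ ε : ℝ, 0 < ε → Tendsto (fun n => μ {ω | ε ≤
        ‖√((m * n : ℕ) : ℝ) • (U n ω - θs) - X n ω‖}) atTop (𝓝 0)) →
        IsLeadingErrorTerm μ θs (fun n => √((m * n : ℕ) : ℝ)) U L ν := by
      intro U hU
      refine ⟨?_, ?_, hνne⟩
      · rw [tendstoInMeasure_iff_norm]
        intro ε hε
        refine (hU ε hε).congr fun n => ?_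
        simp only [smul_sub, hL, sub_zero]
      · simp only [hL]
        exact hclt
    exact ⟨L, L, ν, inferInstance, hlead _ havg, hlead _ hcen⟩
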